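/- Place $2L^2$ qubits at the points $(x,y)\in(\mathbb{Z}/2L)^2$ with $x+y$ even. The Hamiltonian of the 2D toric code on the $L\times L$ torus is $$H=-\sum_{i,j\in\mathbb{Z}/L}\ \prod_{q\in\partial(2i+1,2j)}X_q\;-\sum_{i,j\in\mathbb{Z}/L}\ \prod_{q\in\partial(2i,2j+1)}Z_q ,$$ where $\partial(x,y)$ consists of the four sites $(x\pm1,y)$, $(x,y\pm1)$ (a plaquette; sites that coincide are counted with multiplicity). A local circuit of depth $d$ is a sequence of $d$ layers, each consisting of one-qubit unitaries and of two-qubit unitaries on pairs of qubits that lie on a common plaquette, with pairwise disjoint supports. Theorem. There is a constant $C$ such that for every $L\ge 1$ and every inverse temperature $\beta\in(0,\infty)$ there is a local algorithm of the following form on these $2L^2$ qubits, without further ancillae, whose output is exactly the Gibbs state $e^{-\beta H}/\operatorname{Tr}e^{-\beta H}$. Starting from $|0\rangle^{\otimes 2L^2}$, it applies a local pre-processing circuit of depth at most $CL$; then it makes at most $2L^2+C$ single-qubit measurements in the computational basis, of which $2L^2-2$ are performed simultaneously, on $2L^2-2$ different qubits; then it applies a local post-processing circuit of depth at most $CL$.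 The output is the density matrix averaged over the measurement outcomes. -/

import Mathlib

noncomputable section

namespace ToricCode

/-! ### Qubits of the `L × L` torus -/

/-- The `2 L²` qubits of the `L × L` toric code. They sit at the points `(x, y)` of the torus
`(ℤ / 2L)²` with `x + y` even: `(i, j, false)` is the qubit at `(2i, 2j)` and `(i, j, true)` is the
qubit at `(2i + 1, 2j + 1)`. -/
abbrev Qubit (L : ℕ) : Type := ZMod L × ZMod L × Bool

/-- The four qubits around the `X` plaquette centred at `(2i + 1, 2j)`: left, right, up, down. -/
def xPlaquette {L : ℕ} (i j : ZMod L) : Fin 4 → Qubit L :=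
  ![(i, j, false), (i + 1, j, false), (i, j, true), (i, j - 1, true)]

/-- The four qubits around the `Z` plaquette centred at `(2i, 2j + 1)`: down, up, right, left. -/
def zPlaquette {L : ℕ} (i j : ZMod L) : Fin 4 → Qubit L :=
  ![(i, j, false), (i, j + 1, false), (i, j, true), (i - 1, j, true)]

/-- Two distinct qubits are neighbours if some plaquette contains both. -/
def Neighbours {L : ℕ} (q r : Qubit L) : Prop :=
  q ≠ r ∧ ∃ i j : ZMod L,
    (q ∈ Set.range (xPlaquette i j) ∧ r ∈ Set.range (xPlaquette i j)) ∨
    (q ∈ Set.range (zPlaquette i j) ∧ r ∈ Set.range (zPlaquette i j))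

/-! ### Operators -/

/-- Labels of the computational basis: one bit for each qubit. -/
abbrev Config (L : ℕ) : Type := Qubit L → Fin 2

/-- Operators on the Hilbert space `(ℂ²)^{⊗ 2L²}`, as matrices in the computational basis. -/
abbrev Op (L : ℕ) : Type := Matrix (Config L) (Config L) ℂ

/-- The one-qubit operator `A` acting on the qubit `q` (and as the identity elsewhere). -/
def onQubit {L : ℕ} (q : Qubit L) (A : Matrix (Fin 2) (Fin 2) ℂ) : Op L :=
  Matrix.of fun z w =>
    open Classical in if ∀ s, s ≠ q → z s = w s then A (z q) (w q) else 0

/-- The two-qubit operator `A` acting on the (distinct) qubits `q`, `r`, in this order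
(and as the identity elsewhere). -/
def onPair {L : ℕ} (q r : Qubit L) (A : Matrix (Fin 2 × Fin 2) (Fin 2 × Fin 2) ℂ) : Op L :=
  Matrix.of fun z w =>
    open Classical in if ∀ s, s ≠ q → s ≠ r → z s = w s then A (z q, z r) (w q, w r) else 0

/-- The Pauli matrix `X`. -/
def pauliX : Matrix (Fin 2) (Fin 2) ℂ := !![0, 1; 1, 0]

/-- The Pauli matrix `Z`. -/
def pauliZ : Matrix (Fin 2) (Fin 2) ℂ := !![1, 0; 0, -1]

variable {L : ℕ} [NeZero L]

/-- The product of the four operators `A` on the qubits `s 0, s 1, s 2, s 3`. -/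
def plaquetteTerm (A : Matrix (Fin 2) (Fin 2) ℂ) (s : Fin 4 → Qubit L) : Op L :=
  onQubit (s 0) A * onQubit (s 1) A * onQubit (s 2) A * onQubit (s 3) A

variable (L) in
/-- The toric code Hamiltonian
`H = - ∑ (X plaquette terms) - ∑ (Z plaquette terms)`. -/
def hamiltonian : Op L :=
  - (∑ i : ZMod L, ∑ j : ZMod L, plaquetteTerm pauliX (xPlaquette i j))
  - (∑ i : ZMod L, ∑ j : ZMod L, plaquetteTerm pauliZ (zPlaquette i j))

variable (L) in
/-- The Gibbs state `exp (-β H) / Tr (exp (-β H))`. -/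
def gibbsState (β : ℝ) : Op L :=
  (Matrix.trace (NormedSpace.exp (-(β : ℂ) • hamiltonian L)))⁻¹ •
    NormedSpace.exp (-(β : ℂ) • hamiltonian L)

/-! ### Local circuits -/

variable (L) in
/-- A local gate: a one-qubit unitary, or a two-qubit unitary on neighbouring qubits. -/
inductive LocalGate : Type
  | one (q : Qubit L) (U : Matrix.unitaryGroup (Fin 2) ℂ) : LocalGate
  | two (q r : Qubit L) (h : Neighbours q r) (U : Matrix.unitaryGroup (Fin 2 × Fin 2) ℂ) :
      LocalGate

/-- The qubits on which a gate acts. -/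
def LocalGate.support : LocalGate L → Set (Qubit L)
  | .one q _ => {q}
  | .two q r _ _ => {q, r}

/-- The operator of a gate. -/
def LocalGate.toOp : LocalGate L → Op L
  | .one q U => onQubit q U.1
  | .two q r _ U => onPair q r U.1

variable (L) in
/-- A layer of a local circuit: finitely many local gates on pairwise disjoint sets of qubits. -/
structure Layer : Type where
  gates : List (LocalGate L)
  disjoint_support : gates.Pairwise fun g h => Disjoint g.support h.support

/-- The operator of a layer (its gates commute). -/
def Layer.toOp (ℓ : Layer L) : Op L := (ℓ.gates.map LocalGate.toOp).prod

variable (L) in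
/-- A local circuit: a finite sequence of layers. The head of the list is applied first. -/
abbrev Circuit : Type := List (Layer L)

/-- The depth of a circuit is its number of layers. -/
def Circuit.depth (c : Circuit L) : ℕ := List.length c

/-- The action of a circuit on density matrices: each layer, in turn, sends `ρ` to `U ρ U†`. -/
def Circuit.apply (c : Circuit L) (ρ : Op L) : Op L :=
  List.foldl (fun σ ℓ => ℓ.toOp * σ * ℓ.toOp.conjTranspose) ρ c

/-! ### Measurements in the computational basis -/

/-- The projection onto the computational basis states that agree with `o` on `S`. -/
def outcomeProj (S : Finset (Qubit L)) (o : S → Fin 2) : Op L :=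
  Matrix.diagonal fun z => open Classical in if ∀ q : S, z q = o q then 1 else 0

/-- The simultaneous measurement, in the computational basis, of all the qubits in `S`:
`ρ` becomes the average `∑ₒ Pₒ ρ Pₒ` of the post-measurement states over all the outcomes. -/
def measureQubits (S : Finset (Qubit L)) (ρ : Op L) : Op L :=
  ∑ o : S → Fin 2, outcomeProj S o * ρ * outcomeProj S o

/-! ### Local algorithms -/

variable (L) in
/-- The pure state in which every qubit is in the state `|0⟩`, as a density matrix. -/
def zeroState : Op L := Matrix.single 0 0 1

variable (L) in
/-- A local algorithm on the qubits of the torus, with no other ancillae: a local pre-processing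
circuit, a simultaneous measurement of the qubits in `simultaneous`, then measurements of
single qubits one after another, all in the computational basis, and a local post-processing
circuit. -/
structure LocalAlgorithm : Type where
  pre : Circuit L
  simultaneous : Finset (Qubit L)
  further : List (Qubit L)
  post : Circuit L

/-- The total number of single-qubit measurements. -/
def LocalAlgorithm.numMeasurements (a : LocalAlgorithm L) : ℕ :=
  a.simultaneous.card + a.further.length

/-- The state that the algorithm prepares from `|0⟩ ⊗ ⋯ ⊗ |0⟩`. -/
def LocalAlgorithm.output (a : LocalAlgorithm L) : Op L :=
  a.post.apply
    (a.further.foldl (fun σ q => measureQubits {q} σ)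
      (measureQubits a.simultaneous (a.pre.apply (zeroState L))))

end ToricCode

end

/-!
The Hamiltonian is a sum of commuting Pauli products, so a Clifford unitary turns it into a
classical energy function of the measured bits. The algorithm samples the syndromes from their
Boltzmann distribution by measuring a superposition, and then encodes them.

**Encoding.** The `X` plaquettes are the stars of the vertices of a square lattice whose edges are
the qubits, and the `Z` plaquettes are its faces; a point reflection of the torus (`dual`)
exchanges the two. A comb-shaped spanning tree, rooted at the vertex `0`, assigns to every other
vertex `v` the edge `slot v` to its parent. Its image under the reflection is a spanning tree of
the dual graph, disjoint from it. Two qubits, `slot 0` and `dual (slot 0)`, are left over; they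
carry the logical information. CNOTs performed from the tips of the combs to their roots
(`exists_encoder`) take `X` on `slot v` to the plaquette at `v` and `Z` on `dual (slot v)` to the
plaquette dual to `v`. The comb has `2 L` levels, and the gates of a level fit into a bounded
number of layers. After Hadamard gates on the tree, the Hamiltonian becomes diagonal
(`exists_diagonalising_circuit`). Each of the two root plaquettes is the product of the other ones
of its type, so that its eigenvalue is the parity of their syndrome bits (`markEnergy`).

**Sampling.** With one bit also at each root, the syndromes of each type are `L ^ 2` bits of even
parity, and a string with `k` ones has a probability proportional to `exp (-2 β) ^ k`. The
superposition with the square roots of these probabilities as amplitudes is built by repeatedly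
splitting a qubit which holds the parity of `m + n` bits into two qubits that hold the parities of
`m` and of `n` of them (`splitGate_mulVec`). The squared amplitudes are always products of the
weights `parityWeight`, restricted by the conservation of parity. The splits go along the combs,
the teeth in parallel, hence in depth `O(L)`. As the root bits are determined by the others, a
Hadamard gate on each of them makes them uniform and independent of the rest when everything is
measured (`exists_thermal_circuit`), which is the maximally mixed state of the logical qubits.

**Conclusion.** Measuring all qubits leaves a diagonal matrix proportional to the Boltzmann
weights; its trace is `1` by unitarity, and the encoder conjugates it to the Gibbs state
(`conj_diagonal_eq_gibbsState`).
-/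

noncomputable section

namespace ToricCode

/-! ### One- and two-qubit operators -/

section Operators

variable {L : ℕ} [NeZero L]

theorem onQubit_mulVec (q : Qubit L) (A : Matrix (Fin 2) (Fin 2) ℂ) (φ : Config L → ℂ)
    (z : Config L) :
    (onQubit q A).mulVec φ z = ∑ b, A (z q) b * φ (Function.update z q b) := by
  symm
  refine Fintype.sum_of_injective (fun b => Function.update z q b)
    (Function.update_injective z q) _ _ ?_ ?_
  · intro w hw
    simp only [onQubit, Matrix.of_apply]
    rw [if_neg, zero_mul]
    intro h
    refine hw ⟨w q, ?_⟩
    ext s : 1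
    by_cases hs : s = q
    · subst hs; simp
    · simp [hs, h s hs]
  · intro b
    simp only [onQubit, Matrix.of_apply]
    rw [if_pos]
    · simp
    · intro s hs; simp [hs]

theorem onPair_mulVec {q r : Qubit L} (hqr : q ≠ r)
    (A : Matrix (Fin 2 × Fin 2) (Fin 2 × Fin 2) ℂ) (φ : Config L → ℂ) (z : Config L) :
    (onPair q r A).mulVec φ z =
      ∑ p, A (z q, z r) p * φ (Function.update (Function.update z q p.1) r p.2) := by
  symm
  refine Fintype.sum_of_injective
    (fun p : Fin 2 × Fin 2 => Function.update (Function.update z q p.1) r p.2) ?_ _ _ ?_ ?_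
  · intro p p' h
    have h1 := congrFun h q
    have h2 := congrFun h r
    simp [hqr] at h1 h2
    exact Prod.ext h1 h2
  · intro w hw
    simp only [onPair, Matrix.of_apply]
    rw [if_neg, zero_mul]
    intro h
    refine hw ⟨(w q, w r), ?_⟩
    ext s : 1
    by_cases hs : s = r
    · subst hs; simp
    by_cases hs' : s = q
    · subst hs'; simp [hs]
    · simp [hs, hs', h s hs' hs]
  · intro p
    simp only [onPair, Matrix.of_apply]
    rw [if_pos]
    · simp [hqr]
    · intro s hs hs'; simp [hs, hs']

theorem onQubit_one (q : Qubit L) : onQubit q 1 = (1 : Op L) := by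
  ext z w
  simp only [onQubit, Matrix.of_apply, Matrix.one_apply]
  by_cases h : z = w
  · simp [h]
  · rw [if_neg h]
    split_ifs with h1 h2
    · refine absurd (funext fun s => ?_) h
      by_cases hs : s = q
      · rw [hs, h2]
      · exact h1 s hs
    · rfl
    · rfl

theorem onPair_one (q r : Qubit L) : onPair q r 1 = (1 : Op L) := by
  ext z w
  simp only [onPair, Matrix.of_apply, Matrix.one_apply]
  by_cases h : z = w
  · simp [h]
  · rw [if_neg h]
    split_ifs with h1 h2
    · rw [Prod.mk.injEq] at h2
      refine absurd (funext fun s => ?_) h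
      by_cases hs : s = q
      · rw [hs, h2.1]
      by_cases hs' : s = r
      · rw [hs', h2.2]
      · exact h1 s hs hs'
    · rfl
    · rfl

theorem onQubit_mul (q : Qubit L) (A B : Matrix (Fin 2) (Fin 2) ℂ) :
    onQubit q A * onQubit q B = onQubit q (A * B) := by
  apply Matrix.mulVec_injective
  ext φ z
  rw [← Matrix.mulVec_mulVec]
  simp only [onQubit_mulVec, Fin.sum_univ_two, Matrix.mul_apply, Function.update_self,
    Function.update_idem]
  ring

theorem onPair_mul {q r : Qubit L} (hqr : q ≠ r)
    (A B : Matrix (Fin 2 × Fin 2) (Fin 2 × Fin 2) ℂ) :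
    onPair q r A * onPair q r B = onPair q r (A * B) := by
  apply Matrix.mulVec_injective
  ext φ z
  rw [← Matrix.mulVec_mulVec]
  have hu : ∀ p p' : Fin 2 × Fin 2,
      Function.update (Function.update (Function.update (Function.update z q p.1) r p.2) q p'.1)
        r p'.2 = Function.update (Function.update z q p'.1) r p'.2 := by
    intro p p'
    rw [Function.update_comm hqr.symm, Function.update_idem, Function.update_idem]
  simp only [onPair_mulVec hqr, Matrix.mul_apply, hu, Function.update_self,
    Function.update_of_ne hqr, Finset.mul_sum, Finset.sum_mul]
  rw [Finset.sum_comm]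
  simp only [mul_assoc]

theorem onQubit_comm {q r : Qubit L} (hqr : q ≠ r) (A B : Matrix (Fin 2) (Fin 2) ℂ) :
    onQubit q A * onQubit r B = onQubit r B * onQubit q A := by
  apply Matrix.mulVec_injective
  ext φ z
  rw [← Matrix.mulVec_mulVec, ← Matrix.mulVec_mulVec]
  have hu : ∀ b c, Function.update (Function.update z q b) r c =
      Function.update (Function.update z r c) q b := fun b c => Function.update_comm hqr _ _ _
  simp only [onQubit_mulVec, Fin.sum_univ_two, Function.update_of_ne hqr,
    Function.update_of_ne hqr.symm, hu]
  ring

theorem onQubit_conjTranspose (q : Qubit L) (A : Matrix (Fin 2) (Fin 2) ℂ) :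
    (onQubit q A).conjTranspose = onQubit q A.conjTranspose := by
  ext z w
  simp only [onQubit, Matrix.conjTranspose_apply, Matrix.of_apply, eq_comm (a := w _)]
  split_ifs <;> simp

theorem onPair_conjTranspose (q r : Qubit L) (A : Matrix (Fin 2 × Fin 2) (Fin 2 × Fin 2) ℂ) :
    (onPair q r A).conjTranspose = onPair q r A.conjTranspose := by
  ext z w
  simp only [onPair, Matrix.conjTranspose_apply, Matrix.of_apply, eq_comm (a := w _)]
  split_ifs <;> simp

theorem LocalGate.toOp_mem_unitaryGroup (g : LocalGate L) :
    g.toOp ∈ Matrix.unitaryGroup (Config L) ℂ := by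
  rw [Matrix.mem_unitaryGroup_iff, Matrix.star_eq_conjTranspose]
  cases g with
  | one q U =>
    rw [LocalGate.toOp, onQubit_conjTranspose, onQubit_mul, ← Matrix.star_eq_conjTranspose,
      Matrix.mem_unitaryGroup_iff.1 U.2, onQubit_one]
  | two q r h U =>
    rw [LocalGate.toOp, onPair_conjTranspose, onPair_mul h.1, ← Matrix.star_eq_conjTranspose,
      Matrix.mem_unitaryGroup_iff.1 U.2, onPair_one]

theorem Layer.toOp_mem_unitaryGroup (ℓ : Layer L) :
    ℓ.toOp ∈ Matrix.unitaryGroup (Config L) ℂ := by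
  refine Submonoid.list_prod_mem _ fun A hA => ?_
  obtain ⟨g, -, rfl⟩ := List.mem_map.1 hA
  exact g.toOp_mem_unitaryGroup

/-- The operator of a circuit: the product of the operators of its layers, the head of the list
acting first. -/
def Circuit.toOp (c : Circuit L) : Op L := (c.map Layer.toOp).reverse.prod

theorem Circuit.toOp_nil : Circuit.toOp ([] : Circuit L) = 1 := rfl

theorem Circuit.toOp_cons (ℓ : Layer L) (c : Circuit L) :
    Circuit.toOp (ℓ :: c) = Circuit.toOp c * ℓ.toOp := by
  simp [Circuit.toOp]

theorem Circuit.toOp_append (c c' : Circuit L) :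
    Circuit.toOp (c ++ c') = Circuit.toOp c' * Circuit.toOp c := by
  simp [Circuit.toOp]

theorem Circuit.toOp_mem_unitaryGroup (c : Circuit L) :
    c.toOp ∈ Matrix.unitaryGroup (Config L) ℂ := by
  refine Submonoid.list_prod_mem _ fun A hA => ?_
  obtain ⟨ℓ, -, rfl⟩ := List.mem_map.1 (List.mem_reverse.1 hA)
  exact ℓ.toOp_mem_unitaryGroup

theorem Circuit.apply_eq (c : Circuit L) (ρ : Op L) :
    c.apply ρ = c.toOp * ρ * c.toOp.conjTranspose := by
  induction c generalizing ρ with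
  | nil => simp [Circuit.apply, Circuit.toOp_nil]
  | cons ℓ c ih =>
    have h : Circuit.apply (ℓ :: c) ρ =
      Circuit.apply c (ℓ.toOp * ρ * ℓ.toOp.conjTranspose) := rfl
    rw [h, ih, Circuit.toOp_cons, Matrix.conjTranspose_mul]
    simp only [Matrix.mul_assoc]

/-! ### Measuring every qubit -/

open Classical in
theorem measureQubits_apply (S : Finset (Qubit L)) (ρ : Op L) (z w : Config L) :
    measureQubits S ρ z w = if ∀ q ∈ S, z q = w q then ρ z w else 0 := by
  have key : ∀ o : S → Fin 2, (outcomeProj S o * ρ * outcomeProj S o) z w =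
      if o = (fun q : S => z q) then (if ∀ q ∈ S, z q = w q then ρ z w else 0) else 0 := by
    intro o
    rw [outcomeProj, Matrix.mul_diagonal, Matrix.diagonal_mul]
    by_cases ho : o = fun q : S => z q
    · subst ho
      have : (∀ q : S, w q = z q) ↔ ∀ q ∈ S, z q = w q :=
        ⟨fun h q hq => (h ⟨q, hq⟩).symm, fun h q => (h q q.2).symm⟩
      simp only [this, implies_true, if_true, one_mul]
      split_ifs <;> simp
    · rw [if_neg ho, if_neg, zero_mul, zero_mul]
      exact fun h => ho (funext fun q => (h q).symm)
  rw [measureQubits, Matrix.sum_apply, Finset.sum_congr rfl fun o _ => key o,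
    Finset.sum_ite_eq' Finset.univ]
  simp

open Classical in
theorem measureQubits_foldl_apply (l : List (Qubit L)) (ρ : Op L) (z w : Config L) :
    l.foldl (fun σ q => measureQubits {q} σ) ρ z w =
      if ∀ q ∈ l, z q = w q then ρ z w else 0 := by
  induction l generalizing ρ with
  | nil => simp
  | cons q l ih =>
    rw [List.foldl_cons, ih, measureQubits_apply]
    simp only [List.mem_cons, forall_eq_or_imp, Finset.mem_singleton, forall_eq]
    split_ifs <;> tauto

/-- Measuring every qubit leaves only the diagonal of the density matrix. -/
theorem foldl_measureQubits_eq_diagonal (S : Finset (Qubit L)) (l : List (Qubit L))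
    (h : ∀ q, q ∈ S ∨ q ∈ l) (ρ : Op L) :
    l.foldl (fun σ q => measureQubits {q} σ) (measureQubits S ρ) =
      Matrix.diagonal fun z => ρ z z := by
  classical
  ext z w
  rw [measureQubits_foldl_apply, measureQubits_apply, Matrix.diagonal_apply]
  by_cases hzw : z = w
  · subst hzw; simp
  · rw [if_neg hzw]
    split_ifs with h1 h2
    · exact absurd (funext fun q => (h q).elim (h2 q) (h1 q)) hzw
    · rfl
    · rfl

end Operators

/-! ### Permutations of the basis, Pauli operators, CNOT and Hadamard gates -/

section Gates

variable {L : ℕ}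

/-- The additive map that adds the bit at `c k i` to the bit at `t k i`, for all `k` and all
`i ∈ S k`. It is the effect on basis states of the CNOTs with these controls and targets, provided
that no target is a control. -/
def cnotHom {ι κ : Type*} [Fintype κ] (S : κ → Finset ι) (c t : κ → ι → Qubit L) :
    Config L →+ Config L :=
  AddMonoidHom.mk' (fun z => z + ∑ k, ∑ i ∈ S k, Pi.single (t k i) (z (c k i))) fun z w => by
    simp only [Pi.add_apply, Pi.single_add, Finset.sum_add_distrib]
    abel

theorem cnotHom_apply {ι κ : Type*} [Fintype κ] (S : κ → Finset ι) (c t : κ → ι → Qubit L)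
    (z : Config L) :
    cnotHom S c t z = z + ∑ k, ∑ i ∈ S k, Pi.single (t k i) (z (c k i)) := rfl

variable [NeZero L]

/-- The operator `|w⟩ ↦ |f w⟩` on computational basis states. -/
def permOp (f : Config L → Config L) : Op L := Matrix.of fun z w => if z = f w then 1 else 0

theorem permOp_mul (f g : Config L → Config L) : permOp f * permOp g = permOp (f ∘ g) := by
  ext z w
  simp [permOp, Matrix.mul_apply]

theorem permOp_id : permOp (fun z : Config L => z) = 1 := by
  ext z w
  simp [permOp, Matrix.one_apply]

theorem diagonal_mul_permOp (f : Config L → Config L) (d : Config L → ℂ) :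
    Matrix.diagonal d * permOp f = permOp f * Matrix.diagonal fun z => d (f z) := by
  ext z w
  rw [Matrix.diagonal_mul, Matrix.mul_diagonal]
  simp only [permOp, Matrix.of_apply]
  split_ifs with h
  · rw [h, mul_comm]
  · simp

/-- The sign `(-1) ^ x` of a bit. -/
def sgn (x : Fin 2) : ℝ := if x = 0 then 1 else -1

theorem sgn_add (x y : Fin 2) : sgn (x + y) = sgn x * sgn y := by
  fin_cases x <;> fin_cases y <;> simp [sgn]

theorem onQubit_pauliX (q : Qubit L) : onQubit q pauliX = permOp (fun z => z + Pi.single q 1) := by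
  have hX : ∀ a b : Fin 2, pauliX a b = if a = b + 1 then 1 else 0 := by
    intro a b; fin_cases a <;> fin_cases b <;> simp [pauliX]
  ext z w
  simp only [onQubit, permOp, Matrix.of_apply, hX]
  have : z = w + Pi.single q 1 ↔ (∀ s, s ≠ q → z s = w s) ∧ z q = w q + 1 := by
    constructor
    · rintro rfl
      exact ⟨fun s hs => by simp [hs], by simp⟩
    · rintro ⟨h1, h2⟩
      ext s : 1
      by_cases hs : s = q
      · subst hs; simp [h2]
      · simp [hs, h1 s hs]
  simp only [this]
  split_ifs <;> tauto

theorem onQubit_pauliZ (q : Qubit L) :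
    onQubit q pauliZ = Matrix.diagonal fun z : Config L => (sgn (z q) : ℂ) := by
  have hZ : ∀ a b : Fin 2, pauliZ a b = if a = b then (sgn a : ℂ) else 0 := by
    intro a b; fin_cases a <;> fin_cases b <;> simp [pauliZ, sgn]
  ext z w
  simp only [onQubit, Matrix.diagonal_apply, Matrix.of_apply, hZ]
  have : z = w ↔ (∀ s, s ≠ q → z s = w s) ∧ z q = w q := by
    constructor
    · rintro rfl; simp
    · rintro ⟨h1, h2⟩
      ext s : 1
      by_cases hs : s = q
      · rw [hs, h2]
      · exact h1 s hs
  simp only [this]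
  split_ifs <;> tauto

theorem plaquetteTerm_pauliX (s : Fin 4 → Qubit L) :
    plaquetteTerm pauliX s = permOp (fun z => z + ∑ d, Pi.single (s d) 1) := by
  simp only [plaquetteTerm, onQubit_pauliX, permOp_mul]
  congr 1
  ext1 z
  simp only [Function.comp_apply, Fin.sum_univ_four]
  abel

theorem plaquetteTerm_pauliZ (s : Fin 4 → Qubit L) :
    plaquetteTerm pauliZ s =
      Matrix.diagonal fun z : Config L => (sgn (∑ d, z (s d)) : ℂ) := by
  simp only [plaquetteTerm, onQubit_pauliZ, Matrix.diagonal_mul_diagonal, Fin.sum_univ_four,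
    sgn_add, Complex.ofReal_mul]

/-- The CNOT gate; the first qubit is the control and the second one the target. -/
def cnot : Matrix.unitaryGroup (Fin 2 × Fin 2) ℂ :=
  ⟨Matrix.of fun p r => if p = (r.1, r.1 + r.2) then 1 else 0, by
    rw [Matrix.mem_unitaryGroup_iff]
    ext ⟨a, b⟩ ⟨c, d⟩
    fin_cases a <;> fin_cases b <;> fin_cases c <;> fin_cases d <;>
      simp [Matrix.mul_apply, Fintype.sum_prod_type]⟩

theorem onPair_cnot {c t : Qubit L} (hct : c ≠ t) :
    onPair c t cnot.1 = permOp (fun z => z + Pi.single t (z c)) := by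
  ext z w
  simp only [onPair, permOp, cnot, Matrix.of_apply, Prod.mk.injEq]
  have : z = w + Pi.single t (w c) ↔
      (∀ s, s ≠ c → s ≠ t → z s = w s) ∧ z c = w c ∧ z t = w c + w t := by
    constructor
    · rintro rfl
      exact ⟨fun s _ hs => by simp [hs], by simp [hct], by simp [add_comm]⟩
    · rintro ⟨h1, h2, h3⟩
      ext s : 1
      by_cases hs : s = t
      · subst hs; simp [h3, add_comm]
      by_cases hs' : s = c
      · subst hs'; simp [hs, h2]
      · simp [hs, h1 s hs' hs]
  simp only [this]
  split_ifs <;> tauto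

/-- Two-qubit gates on pairwise disjoint pairs of neighbours form a layer. -/
theorem exists_layer_prod_onPair {ι : Type*} (l : List ι) (c t : ι → Qubit L)
    (U : ι → Matrix.unitaryGroup (Fin 2 × Fin 2) ℂ)
    (hn : ∀ i ∈ l, Neighbours (c i) (t i))
    (hd : l.Pairwise fun i j => Disjoint ({c i, t i} : Set (Qubit L)) {c j, t j}) :
    ∃ ℓ : Layer L, ℓ.toOp = (l.map fun i => onPair (c i) (t i) (U i).1).prod := by
  refine ⟨⟨l.pmap (fun i h => LocalGate.two (c i) (t i) h (U i)) hn, ?_⟩, ?_⟩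
  · rw [List.pairwise_pmap]
    exact hd.imp fun h _ _ => h
  · simp only [Layer.toOp, List.map_pmap, LocalGate.toOp]
    rw [List.pmap_eq_map]

theorem prod_map_onPair_cnot {ι : Type*} (l : List ι) (c t : ι → Qubit L)
    (h : ∀ i ∈ l, ∀ j ∈ l, t i ≠ c j) :
    (l.map fun i => onPair (c i) (t i) cnot.1).prod =
      permOp (fun z => z + (l.map fun i => Pi.single (t i) (z (c i))).sum) := by
  induction l with
  | nil => simp [permOp_id]
  | cons i l ih =>
    have h0 : ∀ z : Config L, (l.map fun j => (Pi.single (t j) (z (c j)) : Config L)).sum (c i)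
        = 0 := by
      intro z
      rw [Pi.list_sum_apply, List.map_map]
      refine List.sum_eq_zero fun x hx => ?_
      obtain ⟨j, hj, rfl⟩ := List.mem_map.1 hx
      have := h j (by simp [hj]) i (by simp)
      simp [this.symm]
    rw [List.map_cons, List.prod_cons, onPair_cnot (h i (by simp) i (by simp)).symm,
      ih fun j hj k hk => h j (by simp [hj]) k (by simp [hk]), permOp_mul]
    congr 1
    ext1 z
    simp only [Function.comp_apply, Pi.add_apply, h0, add_zero, List.map_cons, List.sum_cons]
    abel

theorem exists_circuit_cnotHom {ι κ : Type*} [Fintype κ] (S : κ → Finset ι)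
    (c t : κ → ι → Qubit L)
    (hn : ∀ k, ∀ i ∈ S k, Neighbours (c k i) (t k i))
    (hct : ∀ k k', ∀ i ∈ S k, ∀ j ∈ S k', t k i ≠ c k' j)
    (hc : ∀ k, Set.InjOn (c k) (S k)) (ht : ∀ k, Set.InjOn (t k) (S k)) :
    ∃ C : Circuit L, C.depth = Fintype.card κ ∧ C.toOp = permOp (cnotHom S c t) := by
  classical
  have hlayer : ∀ k, ∃ ℓ : Layer L,
      ℓ.toOp = permOp (fun z => z + ∑ i ∈ S k, Pi.single (t k i) (z (c k i))) := by
    intro k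
    obtain ⟨ℓ, hℓ⟩ := exists_layer_prod_onPair (S k).toList (c k) (t k) (fun _ => cnot)
      (fun i hi => hn k i (Finset.mem_toList.1 hi))
      ((S k).nodup_toList.pairwise_of_forall_ne fun i hi j hj hij => by
        rw [Finset.mem_toList] at hi hj
        simp only [Set.disjoint_insert_left, Set.disjoint_singleton_left, Set.mem_insert_iff,
          Set.mem_singleton_iff, not_or]
        exact ⟨⟨fun h => hij (hc k hi hj h), (hct k k j hj i hi).symm⟩,
          hct k k i hi j hj, fun h => hij (ht k hi hj h)⟩)
    refine ⟨ℓ, ?_⟩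
    rw [hℓ, prod_map_onPair_cnot]
    · simp only [Finset.sum_map_toList]
    · intro i hi j hj
      exact hct k k i (Finset.mem_toList.1 hi) j (Finset.mem_toList.1 hj)
  choose ℓ hℓ using hlayer
  have key : ∀ D : List κ, Circuit.toOp (D.map ℓ) =
      permOp (fun z => z + (D.map fun k => ∑ i ∈ S k, Pi.single (t k i) (z (c k i))).sum) := by
    intro D
    induction D with
    | nil => simp [permOp_id, Circuit.toOp_nil]
    | cons k D ih =>
      rw [List.map_cons, Circuit.toOp_cons, ih, hℓ, permOp_mul]
      congr 1
      ext1 z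
      have h0 : ∀ k', ∀ j ∈ S k',
          (z + ∑ i ∈ S k, Pi.single (t k i) (z (c k i)) : Config L) (c k' j) = z (c k' j) := by
        intro k' j hj
        rw [Pi.add_apply, Finset.sum_apply, Finset.sum_eq_zero, add_zero]
        intro i hi
        simp [(hct k k' i hi j hj).symm]
      have h1 : ∀ k', ∑ j ∈ S k', (Pi.single (t k' j)
          ((z + ∑ i ∈ S k, Pi.single (t k i) (z (c k i)) : Config L) (c k' j)) : Config L) =
          ∑ j ∈ S k', Pi.single (t k' j) (z (c k' j)) :=
        fun k' => Finset.sum_congr rfl fun j hj => by rw [h0 k' j hj]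
      simp only [Function.comp_apply, h1, List.map_cons, List.sum_cons]
      abel
  refine ⟨(Finset.univ : Finset κ).toList.map ℓ, ?_, ?_⟩
  · rw [Circuit.depth, List.length_map, Finset.length_toList, Finset.card_univ]
  · rw [key]
    congr 1
    ext1 z
    rw [cnotHom_apply, Finset.sum_map_toList]

/-- The Hadamard gate. -/
def hadamard : Matrix.unitaryGroup (Fin 2) ℂ :=
  ⟨((√2 : ℝ) : ℂ)⁻¹ • !![1, 1; 1, -1], by
    rw [Matrix.mem_unitaryGroup_iff]
    have h2 : (((√2 : ℝ) : ℂ))⁻¹ * (((√2 : ℝ) : ℂ))⁻¹ = 1 / 2 := by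
      rw [← mul_inv, ← Complex.ofReal_mul, Real.mul_self_sqrt (by norm_num)]
      norm_num
    ext a b
    fin_cases a <;> fin_cases b <;>
      simp [Matrix.mul_apply, Matrix.star_apply, h2] <;> norm_num⟩

theorem hadamard_apply (a b : Fin 2) :
    hadamard.1 a b = (((√2)⁻¹ * (if a = 1 ∧ b = 1 then -1 else 1) : ℝ) : ℂ) := by
  fin_cases a <;> fin_cases b <;> simp [hadamard]

theorem pauliX_mul_hadamard : pauliX * hadamard.1 = hadamard.1 * pauliZ := by
  simp only [pauliX, pauliZ, hadamard, Matrix.mul_smul, Matrix.smul_mul]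
  congr 1
  ext a b
  fin_cases a <;> fin_cases b <;> simp [Matrix.mul_apply]

/-- Hadamard gates on all the qubits of `S`. -/
def hadamardOp (S : Finset (Qubit L)) : Op L :=
  (S.toList.map fun q => onQubit q hadamard.1).prod

theorem exists_layer_hadamardOp (S : Finset (Qubit L)) : ∃ ℓ : Layer L, ℓ.toOp = hadamardOp S := by
  refine ⟨⟨S.toList.map fun q => LocalGate.one q hadamard, ?_⟩, ?_⟩
  · rw [List.pairwise_map]
    refine S.nodup_toList.imp fun h => ?_
    simpa [LocalGate.support] using h
  · simp [Layer.toOp, hadamardOp, LocalGate.toOp, Function.comp_def]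

theorem onQubit_comm_prod_hadamard {q : Qubit L} {l : List (Qubit L)} (hq : q ∉ l)
    (A : Matrix (Fin 2) (Fin 2) ℂ) :
    onQubit q A * (l.map fun r => onQubit r hadamard.1).prod =
      (l.map fun r => onQubit r hadamard.1).prod * onQubit q A := by
  refine Commute.list_prod_right _ _ fun B hB => ?_
  obtain ⟨r, hr, rfl⟩ := List.mem_map.1 hB
  exact onQubit_comm (by rintro rfl; exact hq hr) _ _

theorem pauliZ_mul_hadamardOp {S : Finset (Qubit L)} {q : Qubit L} (hq : q ∉ S) :
    (Matrix.diagonal fun z : Config L => (sgn (z q) : ℂ)) * hadamardOp S =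
      hadamardOp S * Matrix.diagonal fun z => (sgn (z q) : ℂ) := by
  rw [← onQubit_pauliZ]
  exact onQubit_comm_prod_hadamard (by simpa using hq) _

theorem pauliX_mul_hadamardOp {S : Finset (Qubit L)} {q : Qubit L} (hq : q ∈ S) :
    permOp (fun z => z + Pi.single q 1) * hadamardOp S =
      hadamardOp S * Matrix.diagonal fun z => (sgn (z q) : ℂ) := by
  rw [← onQubit_pauliZ, ← onQubit_pauliX, hadamardOp]
  have hl := S.nodup_toList
  rw [← Finset.mem_toList] at hq
  generalize S.toList = l at hl hq
  induction l with
  | nil => simp at hq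
  | cons r l ih =>
    rw [List.nodup_cons] at hl
    rw [List.map_cons, List.prod_cons]
    by_cases h : q = r
    · subst h
      rw [← mul_assoc, onQubit_mul, pauliX_mul_hadamard, ← onQubit_mul, mul_assoc,
        onQubit_comm_prod_hadamard hl.1, ← mul_assoc]
    · rw [← mul_assoc, onQubit_comm h, mul_assoc, ih hl.2 (by simpa [h] using hq), ← mul_assoc]

/-- Conjugation by Hadamard gates turns products of `X` operators into products of `Z` operators. -/
theorem pauliX_sum_mul_hadamardOp {S : Finset (Qubit L)} {ι : Type*} (T : Finset ι)
    (q : ι → Qubit L) (hq : ∀ i ∈ T, q i ∈ S) :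
    permOp (fun z => z + ∑ i ∈ T, Pi.single (q i) 1) * hadamardOp S =
      hadamardOp S * Matrix.diagonal fun z => (sgn (∑ i ∈ T, z (q i)) : ℂ) := by
  classical
  induction T using Finset.induction_on with
  | empty => simp [permOp_id, sgn]
  | insert i T hi ih =>
    have h1 : permOp (fun z : Config L => z + ∑ j ∈ insert i T, Pi.single (q j) 1) =
        permOp (fun z => z + Pi.single (q i) 1) *
          permOp (fun z => z + ∑ j ∈ T, Pi.single (q j) 1) := by
      rw [permOp_mul]
      congr 1
      ext1 z
      simp only [Finset.sum_insert hi, Function.comp_apply]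
      abel
    rw [h1, mul_assoc, ih fun j hj => hq j (Finset.mem_insert_of_mem hj), ← mul_assoc,
      pauliX_mul_hadamardOp (hq i (Finset.mem_insert_self i T)), mul_assoc,
      Matrix.diagonal_mul_diagonal]
    simp only [Finset.sum_insert hi, sgn_add, Complex.ofReal_mul]

theorem pauliZ_sum_mul_hadamardOp {S : Finset (Qubit L)} {ι : Type*} (T : Finset ι)
    (q : ι → Qubit L) (hq : ∀ i ∈ T, q i ∉ S) :
    (Matrix.diagonal fun z : Config L => (sgn (∑ i ∈ T, z (q i)) : ℂ)) * hadamardOp S =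
      hadamardOp S * Matrix.diagonal fun z => (sgn (∑ i ∈ T, z (q i)) : ℂ) := by
  classical
  induction T using Finset.induction_on with
  | empty => simp [sgn]
  | insert i T hi ih =>
    have h1 : (Matrix.diagonal fun z : Config L => (sgn (∑ j ∈ insert i T, z (q j)) : ℂ)) =
        (Matrix.diagonal fun z => (sgn (z (q i)) : ℂ)) *
          Matrix.diagonal fun z => (sgn (∑ j ∈ T, z (q j)) : ℂ) := by
      simp only [Matrix.diagonal_mul_diagonal, Finset.sum_insert hi, sgn_add, Complex.ofReal_mul]
    rw [h1, mul_assoc, ih fun j hj => hq j (Finset.mem_insert_of_mem hj), ← mul_assoc,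
      pauliZ_mul_hadamardOp (hq i (Finset.mem_insert_self i T)), mul_assoc]

end Gates

/-! ### The spanning tree and its dual -/

section Geometry

variable {L : ℕ}

/-- The vertices of the lattice: `v` stands for the centre `(2 v.1 + 1, 2 v.2)` of an `X` plaquette.
The qubits are the edges: `(i, j, false)` joins the vertices `(i - 1, j)` and `(i, j)`, and
`(i, j, true)` joins the vertices `(i, j)` and `(i, j + 1)`. -/
abbrev Vertex (L : ℕ) : Type := ZMod L × ZMod L

/-- The four edges at a vertex. -/
def edges (v : Vertex L) : Fin 4 → Qubit L := xPlaquette v.1 v.2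

/-- The point reflection `(x, y) ↦ (-1 - x, -1 - y)` of the torus. It exchanges the `X` plaquettes
with the `Z` plaquettes. -/
def dual (q : Qubit L) : Qubit L := (-1 - q.1, -1 - q.2.1, !q.2.2)

/-- The edge from the vertex `v` to its parent in the comb-shaped spanning tree with root `0`: the
spine of the comb is the row `v.2 = 0` and its teeth are the columns. The edges of the tree are
the `slot v` with `v ≠ 0`; those of the dual tree are their images under `dual`. The two edges
`slot 0` and `dual (slot 0)` are left over. -/
def slot (v : Vertex L) : Qubit L :=
  if v.2 = 0 then (v.1, 0, false) else (v.1, v.2 - 1, true)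

/-- A numbering of the vertices that increases from the root of the comb to its tips. -/
def height (v : Vertex L) : ℕ := if v.2 = 0 then v.1.val else L + v.2.val

theorem dual_dual (q : Qubit L) : dual (dual q) = q := by
  simp [dual]

theorem dual_injective : Function.Injective (dual : Qubit L → Qubit L) :=
  Function.LeftInverse.injective dual_dual

theorem height_lt [NeZero L] (v : Vertex L) : height v < 2 * L := by
  have h1 := ZMod.val_lt v.1
  have h2 := ZMod.val_lt v.2
  unfold height
  split_ifs <;> omega

theorem slot_injective : Function.Injective (slot : Vertex L → Qubit L) := by
  rintro ⟨i, j⟩ ⟨i', j'⟩ h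
  unfold slot at h
  split_ifs at h with h1 h2 h2 <;> simp_all

theorem slot_ne_dual_slot (u v : Vertex L) : slot u ≠ dual (slot v) := by
  intro h
  unfold slot dual at h
  split_ifs at h with h1 h2 h2 <;> simp only [Prod.mk.injEq, Bool.not_true, Bool.not_false] at h
  · simp at h
  · exact h2 (by linear_combination h.2.1)
  · exact h1 (by linear_combination h.2.1)
  · simp at h

theorem exists_edges_eq_slot (v : Vertex L) : ∃ d, edges v d = slot v := by
  unfold slot edges xPlaquette
  split_ifs with h
  · exact ⟨0, by simp [h]⟩
  · exact ⟨3, by simp⟩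

theorem val_sub_one [NeZero L] {j : ZMod L} (hj : j ≠ 0) : (j - 1).val + 1 = j.val := by
  have h1 : j.val ≠ 0 := by rwa [Ne, ZMod.val_eq_zero]
  have h2 := ZMod.val_lt j
  have h3 : j - 1 = ((j.val - 1 : ℕ) : ZMod L) := by
    rw [Nat.cast_sub (by omega), ZMod.natCast_zmod_val, Nat.cast_one]
  rw [h3, ZMod.val_cast_of_lt (by omega)]
  omega

/-- The edge from `u` to its parent is an edge of `u` and of the parent only. -/
theorem eq_or_height_lt [NeZero L] {u v : Vertex L} (hu : u ≠ 0) {d : Fin 4}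
    (h : edges v d = slot u) :
    u = v ∨ height v < height u := by
  obtain ⟨i, j⟩ := u
  obtain ⟨a, b⟩ := v
  have ha := ZMod.val_lt a
  unfold slot at h
  unfold height
  by_cases hj : j = 0
  · have hi : i ≠ 0 := by rintro rfl; exact hu (by rw [hj]; rfl)
    fin_cases d <;> simp [edges, xPlaquette, hj] at h
    · left; rw [h.1, h.2, hj]
    · right
      have := val_sub_one hi
      rw [← h.1, add_sub_cancel_right] at this
      simp only [h.2, hj, if_true, ← h.1]
      omega
  · have hv := val_sub_one hj
    fin_cases d <;> simp [edges, xPlaquette, hj] at h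
    · right
      rw [← h.2] at hv
      simp only [hj, if_false]
      split_ifs <;> omega
    · left; rw [h.1, h.2]

theorem edges_left_injective (d : Fin 4) : Function.Injective fun v : Vertex L => edges v d := by
  rintro ⟨i, j⟩ ⟨i', j'⟩ h
  fin_cases d <;> simpa [edges, xPlaquette] using h

theorem edges_injective {v : Vertex L} (hv : v ≠ 0) : Function.Injective (edges v) := by
  have h1 : (1 : ZMod L) ≠ 0 := by
    intro h
    have : Subsingleton (ZMod L) := subsingleton_of_zero_eq_one h.symm
    exact hv (Subsingleton.elim _ _)
  intro d d' h
  have h2 : ∀ j : ZMod L, j ≠ j - 1 := fun j h => h1 (by linear_combination h)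
  fin_cases d <;> fin_cases d' <;> simp_all [edges, xPlaquette]

theorem neighbours_edges {v : Vertex L} {d d' : Fin 4} (h : edges v d ≠ edges v d') :
    Neighbours (edges v d) (edges v d') :=
  ⟨h, v.1, v.2, Or.inl ⟨⟨d, rfl⟩, d', rfl⟩⟩

theorem dual_edges (v : Vertex L) :
    dual (edges v 0) = zPlaquette (-1 - v.1) (-1 - v.2) 2 ∧
    dual (edges v 1) = zPlaquette (-1 - v.1) (-1 - v.2) 3 ∧
    dual (edges v 2) = zPlaquette (-1 - v.1) (-1 - v.2) 0 ∧
    dual (edges v 3) = zPlaquette (-1 - v.1) (-1 - v.2) 1 := by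
  refine ⟨?_, ?_, ?_, ?_⟩ <;> simp [dual, edges, xPlaquette, zPlaquette] <;> ring

theorem neighbours_dual_edges {v : Vertex L} {d d' : Fin 4} (h : edges v d ≠ edges v d') :
    Neighbours (dual (edges v d)) (dual (edges v d')) := by
  obtain ⟨h0, h1, h2, h3⟩ := dual_edges v
  have key : ∀ d, dual (edges v d) ∈ Set.range (zPlaquette (-1 - v.1) (-1 - v.2)) := by
    intro d
    fin_cases d
    exacts [⟨_, h0.symm⟩, ⟨_, h1.symm⟩, ⟨_, h2.symm⟩, ⟨_, h3.symm⟩]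
  exact ⟨fun e => h (dual_injective e), _, _, Or.inr ⟨key d, key d'⟩⟩

theorem plaquetteTerm_zPlaquette [NeZero L] (v : Vertex L) :
    plaquetteTerm pauliZ (zPlaquette (-1 - v.1) (-1 - v.2)) =
      Matrix.diagonal fun z : Config L => (sgn (∑ d, z (dual (edges v d))) : ℂ) := by
  obtain ⟨h0, h1, h2, h3⟩ := dual_edges v
  rw [plaquetteTerm_pauliZ]
  congr 1
  ext1 z
  simp only [Fin.sum_univ_four, h0, h1, h2, h3]
  congr 2
  abel

theorem bit_add_self (x : Fin 2) : x + x = 0 := by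
  fin_cases x <;> rfl

theorem config_add_self (z : Config L) : z + z = 0 := funext fun _ => bit_add_self _

/-- Every edge belongs to two vertices. -/
theorem sum_sum_edges [NeZero L] {A : Type*} [AddCommMonoid A] (hA : ∀ x : A, x + x = 0)
    (F : Qubit L → A) :
    ∑ v : Vertex L, ∑ d, F (edges v d) = 0 := by
  have h1 : ∑ v : Vertex L, F (v.1 + 1, v.2, false) = ∑ v : Vertex L, F (v.1, v.2, false) :=
    Equiv.sum_comp ((Equiv.addRight (1 : ZMod L)).prodCongr (Equiv.refl _))
      fun v : Vertex L => F (v.1, v.2, false)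
  have h2 : ∑ v : Vertex L, F (v.1, v.2 - 1, true) = ∑ v : Vertex L, F (v.1, v.2, true) :=
    Equiv.sum_comp ((Equiv.refl _).prodCongr (Equiv.subRight (1 : ZMod L)))
      fun v : Vertex L => F (v.1, v.2, true)
  simp only [Fin.sum_univ_four, Finset.sum_add_distrib]
  simp only [edges, xPlaquette, Matrix.cons_val]
  rw [h1, h2, hA, zero_add, hA]

/-- An `X` plaquette and a `Z` plaquette share an even number of qubits. -/
theorem sum_edges_dual_edges (u v : Vertex L) :
    ∑ d, (∑ d', Pi.single (edges v d') 1 : Config L) (dual (edges u d)) = 0 := by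
  obtain ⟨i, j⟩ := v
  obtain ⟨a, b⟩ := u
  have e1 : (-1 - a = i + 1) ↔ (-1 - (a + 1) = i) :=
    ⟨fun h => by linear_combination h, fun h => by linear_combination h⟩
  have e2 : (-1 - (b - 1) = j) ↔ (-1 - b = j - 1) :=
    ⟨fun h => by linear_combination h, fun h => by linear_combination h⟩
  have bits : ∀ x y z w : Fin 2, x + y + (z + w) + (x + z) + (y + w) = 0 := by decide
  simp only [Fin.sum_univ_four, edges, xPlaquette, dual, Matrix.cons_val, Pi.add_apply,
    Pi.single_apply, Prod.mk.injEq, Bool.not_true, Bool.not_false, and_true, and_false,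
    if_false, reduceCtorEq, add_zero, zero_add, e1, e2]
  exact bits _ _ _ _

end Geometry

/-! ### The encoding circuit -/

section Encoder

variable {L : ℕ} [NeZero L]

open Classical in
variable (L) in
/-- The vertices of height `k` other than the root. -/
def level (k : ℕ) : Finset (Vertex L) :=
  Finset.univ.filter fun v => v ≠ 0 ∧ height v = k

theorem mem_level {k : ℕ} {v : Vertex L} : v ∈ level L k ↔ v ≠ 0 ∧ height v = k := by
  simp [level]

theorem permOp_comp_hom (M N : Config L →+ Config L) :
    permOp M * permOp N = permOp (M.comp N : Config L →+ Config L) :=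
  permOp_mul _ _

/-- A linear circuit of CNOTs that turns the operator `X` on each tree edge `slot v` into the
product of the `X` operators around `v`, and fixes the `X` on every other edge. Each tree edge
controls a CNOT onto every other edge at its vertex; the leaves go first, so that a control still
holds its original bit when it is used. Only the vertices of height less than `k` are treated. -/
theorem exists_star_circuit (k : ℕ) :
    ∃ (C : Circuit L) (M : Config L →+ Config L), C.depth = 4 * k ∧ C.toOp = permOp M ∧
      (∀ z : Config L, (∀ v, v ≠ 0 → height v < k → z (slot v) = 0) → M z = z) ∧
      ∀ v, v ≠ 0 → height v < k → M (Pi.single (slot v) 1) = ∑ d, Pi.single (edges v d) 1 := by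
  classical
  induction k with
  | zero => exact ⟨[], AddMonoidHom.id _, rfl, permOp_id.symm, by simp, by simp⟩
  | succ k ih =>
    obtain ⟨C, M, hC, hM, hfix, hstar⟩ := ih
    set S : Fin 4 → Finset (Vertex L) := fun d =>
      (level L k).filter fun v => edges v d ≠ slot v with hS
    have mem : ∀ {d v}, v ∈ S d ↔ (v ≠ 0 ∧ height v = k) ∧ edges v d ≠ slot v := by
      intro d v; rw [hS, Finset.mem_filter, mem_level]
    obtain ⟨C', hC', hN⟩ := exists_circuit_cnotHom S (fun _ v => slot v) (fun d v => edges v d)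
      (fun d v hv => by
        obtain ⟨e, he⟩ := exists_edges_eq_slot v
        rw [← he]
        exact neighbours_edges (by rw [he]; exact (mem.1 hv).2.symm))
      (fun d d' v hv u hu h => by
        rcases eq_or_height_lt (mem.1 hu).1.1 h with rfl | h'
        · exact (mem.1 hv).2 h
        · rw [(mem.1 hv).1.2, (mem.1 hu).1.2] at h'
          exact lt_irrefl _ h')
      (fun _ => slot_injective.injOn) (fun d => (edges_left_injective d).injOn)
    set N := cnotHom S (fun _ v => slot v) (fun d v => edges v d)
    have hNfix : ∀ z : Config L, (∀ v, v ≠ 0 → height v = k → z (slot v) = 0) → N z = z := by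
      intro z hz
      rw [cnotHom_apply, add_eq_left]
      refine Finset.sum_eq_zero fun d _ => Finset.sum_eq_zero fun v hv => ?_
      rw [hz v (mem.1 hv).1.1 (mem.1 hv).1.2, Pi.single_zero]
    have hNstar : ∀ v, v ≠ 0 → height v = k →
        N (Pi.single (slot v) 1) = ∑ d, Pi.single (edges v d) 1 := by
      intro v hv0 hvk
      have h1 : ∀ d, ∑ u ∈ S d, (Pi.single (edges u d)
          ((Pi.single (slot v) 1 : Config L) (slot u)) : Config L) =
          if edges v d ≠ slot v then Pi.single (edges v d) 1 else 0 := by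
        intro d
        rw [Finset.sum_congr rfl (g := fun u => if u = v then Pi.single (edges v d) 1 else 0)]
        · rw [Finset.sum_ite_eq']
          simp only [mem, hv0, hvk, ne_eq, not_false_eq_true, true_and]
        · intro u _
          by_cases huv : u = v
          · subst huv; simp
          · rw [Pi.single_eq_of_ne (fun h => huv (slot_injective h)), Pi.single_zero, if_neg huv]
      obtain ⟨e, he⟩ := exists_edges_eq_slot v
      rw [cnotHom_apply, Finset.sum_congr rfl fun d _ => h1 d]
      have h2 : ∀ d, edges v d ≠ slot v ↔ d ≠ e := fun d => by
        rw [← he, (edges_injective hv0).ne_iff]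
      simp only [h2]
      rw [← Finset.sum_filter, Finset.filter_ne', ← he]
      exact Finset.add_sum_erase Finset.univ (fun d => (Pi.single (edges v d) 1 : Config L))
        (Finset.mem_univ e)
    refine ⟨C' ++ C, M.comp N, ?_, ?_, ?_, ?_⟩
    · simp only [Circuit.depth, List.length_append, Fintype.card_fin] at hC hC' ⊢
      omega
    · rw [Circuit.toOp_append, hM, hN, permOp_comp_hom]
    · intro z hz
      rw [AddMonoidHom.comp_apply, hNfix z fun v hv h => hz v hv (by omega),
        hfix z fun v hv h => hz v hv (by omega)]
    · intro v hv0 hv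
      rw [AddMonoidHom.comp_apply]
      rcases Nat.lt_succ_iff_lt_or_eq.1 hv with hlt | heq
      · rw [hNfix, hstar v hv0 hlt]
        intro u _ hu
        exact Pi.single_eq_of_ne (fun h => by rw [slot_injective h] at hu; omega) _
      · rw [hNstar v hv0 heq, hfix]
        intro u hu0 hu
        rw [Finset.sum_apply]
        refine Finset.sum_eq_zero fun d _ => Pi.single_eq_of_ne (fun h => ?_) _
        rcases eq_or_height_lt hu0 h.symm with rfl | h' <;> omega

open Classical in
/-- The parity of `z` around the face dual to `v`, the edges of the tree left out. -/
def cotreeFlux (v : Vertex L) (z : Config L) : Fin 2 :=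
  ∑ d, if ∃ u, u ≠ 0 ∧ dual (edges v d) = slot u then 0 else z (dual (edges v d))

/-- A linear circuit of CNOTs that writes onto the non-tree edges a configuration whose flux through
the face dual to `v` is the original bit of the edge `dual (slot v)`. This edge is the target of
CNOTs from the other non-tree edges of its face; the tips of the dual comb go first, so that a face
is not disturbed any more once its own edge has been set. Only the faces of height less than `k`
are treated. -/
theorem exists_face_circuit (k : ℕ) :
    ∃ (C : Circuit L) (M : Config L →+ Config L), C.depth = 4 * k ∧ C.toOp = permOp M ∧
      (∀ z : Config L, (∀ q, z q ≠ 0 → ∃ u, u ≠ 0 ∧ q = slot u) → M z = z) ∧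
      (∀ z q, (∀ v, v ≠ 0 → height v < k → q ≠ dual (slot v)) → M z q = z q) ∧
      ∀ z v, v ≠ 0 → height v < k → cotreeFlux v (M z) = z (dual (slot v)) := by
  classical
  induction k with
  | zero => exact ⟨[], AddMonoidHom.id _, rfl, permOp_id.symm, by simp, by simp, by simp⟩
  | succ k ih =>
    obtain ⟨C, M, hC, hM, htree, hoff, hflux⟩ := ih
    set S : Fin 4 → Finset (Vertex L) := fun d => (level L k).filter fun v =>
      edges v d ≠ slot v ∧ ¬ ∃ u, u ≠ 0 ∧ dual (edges v d) = slot u with hS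
    have mem : ∀ {d v}, v ∈ S d ↔ (v ≠ 0 ∧ height v = k) ∧ edges v d ≠ slot v ∧
        ¬ ∃ u, u ≠ 0 ∧ dual (edges v d) = slot u := by
      intro d v; rw [hS, Finset.mem_filter, mem_level]
    obtain ⟨C', hC', hN⟩ := exists_circuit_cnotHom S (fun d v => dual (edges v d))
      (fun _ v => dual (slot v))
      (fun d v hv => by
        obtain ⟨e, he⟩ := exists_edges_eq_slot v
        rw [← he]
        exact neighbours_dual_edges (by rw [he]; exact (mem.1 hv).2.1))
      (fun d d' u hu v hv h => by
        have h := (dual_injective h).symm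
        rcases eq_or_height_lt (mem.1 hu).1.1 h with rfl | h'
        · exact (mem.1 hv).2.1 h
        · rw [(mem.1 hv).1.2, (mem.1 hu).1.2] at h'
          exact lt_irrefl _ h')
      (fun d => (dual_injective.comp (edges_left_injective d)).injOn)
      (fun _ => (dual_injective.comp slot_injective).injOn)
    set N := cnotHom S (fun d v => dual (edges v d)) (fun _ v => dual (slot v))
    have hNtree : ∀ z : Config L, (∀ q, z q ≠ 0 → ∃ u, u ≠ 0 ∧ q = slot u) → N z = z := by
      intro z hz
      rw [cnotHom_apply, add_eq_left]
      refine Finset.sum_eq_zero fun d _ => Finset.sum_eq_zero fun v hv => ?_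
      rw [not_imp_comm.1 (hz _) (mem.1 hv).2.2, Pi.single_zero]
    have hNoff : ∀ z q, (∀ v, v ≠ 0 → height v = k → q ≠ dual (slot v)) → N z q = z q := by
      intro z q hq
      rw [cnotHom_apply, Pi.add_apply, add_eq_left, Finset.sum_apply]
      refine Finset.sum_eq_zero fun d _ => ?_
      rw [Finset.sum_apply]
      exact Finset.sum_eq_zero fun v hv =>
        Pi.single_eq_of_ne (hq v (mem.1 hv).1.1 (mem.1 hv).1.2) _
    have hNslot : ∀ z v, v ≠ 0 → height v = k → N z (dual (slot v)) = z (dual (slot v)) +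
        ∑ d, if edges v d ≠ slot v ∧ ¬ ∃ u, u ≠ 0 ∧ dual (edges v d) = slot u
          then z (dual (edges v d)) else 0 := by
      intro z v hv0 hvk
      rw [cnotHom_apply, Pi.add_apply, Finset.sum_apply]
      congr 1
      refine Finset.sum_congr rfl fun d _ => ?_
      rw [Finset.sum_apply, Finset.sum_congr rfl
        (g := fun u => if u = v then z (dual (edges v d)) else 0)]
      · rw [Finset.sum_ite_eq']
        simp only [mem, hv0, hvk, ne_eq, not_false_eq_true, true_and]
      · intro u _
        by_cases huv : u = v
        · subst huv; simp
        · rw [if_neg huv]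
          exact Pi.single_eq_of_ne (fun h => huv (slot_injective (dual_injective h)).symm) _
    refine ⟨C' ++ C, M.comp N, ?_, ?_, ?_, ?_, ?_⟩
    · simp only [Circuit.depth, List.length_append, Fintype.card_fin] at hC hC' ⊢
      omega
    · rw [Circuit.toOp_append, hM, hN, permOp_comp_hom]
    · intro z hz
      rw [AddMonoidHom.comp_apply, hNtree z hz, htree z hz]
    · intro z q hq
      rw [AddMonoidHom.comp_apply, hoff _ q fun v hv h => hq v hv (by omega),
        hNoff z q fun v hv h => hq v hv (by omega)]
    · intro z v hv0 hv
      rw [AddMonoidHom.comp_apply]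
      rcases Nat.lt_succ_iff_lt_or_eq.1 hv with hlt | heq
      · rw [hflux _ v hv0 hlt, hNoff]
        intro u _ hu h
        rw [slot_injective (dual_injective h)] at hlt
        omega
      · -- the later CNOTs leave this face alone
        have h1 : ∀ d, M (N z) (dual (edges v d)) = N z (dual (edges v d)) := by
          intro d
          refine hoff _ _ fun u hu0 hu h => ?_
          rcases eq_or_height_lt hu0 (dual_injective h) with rfl | h' <;> omega
        obtain ⟨e, he⟩ := exists_edges_eq_slot v
        have hne : ∀ d, d ≠ e → edges v d ≠ slot v := fun d hd h =>
          hd (edges_injective hv0 (h.trans he.symm))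
        have h2 : ∀ d, d ≠ e → N z (dual (edges v d)) = z (dual (edges v d)) := by
          intro d hd
          refine hNoff _ _ fun u hu0 hu h => ?_
          rcases eq_or_height_lt hu0 (dual_injective h) with rfl | h'
          · exact hne d hd (dual_injective h)
          · omega
        have h3 : ¬ ∃ u : Vertex L, u ≠ 0 ∧ dual (edges v e) = slot u := by
          rintro ⟨u, -, h⟩
          rw [he] at h
          exact slot_ne_dual_slot u v h.symm
        have h4 : ∀ x y : Fin 2, x + y + y = x := by decide
        simp only [cotreeFlux, h1]
        rw [← Finset.add_sum_erase _ _ (Finset.mem_univ e), if_neg h3, he, hNslot z v hv0 heq,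
          ← Finset.add_sum_erase (a := e) _ _ (Finset.mem_univ e), if_neg (by simp [he]), zero_add]
        rw [Finset.sum_congr rfl (g := fun d =>
          if edges v d ≠ slot v ∧ ¬ ∃ u, u ≠ 0 ∧ dual (edges v d) = slot u
          then z (dual (edges v d)) else 0) (s₁ := Finset.univ.erase e) (s₂ := Finset.univ.erase e)
          (f := fun d => if ∃ u, u ≠ 0 ∧ dual (edges v d) = slot u then 0
            else N z (dual (edges v d)))]
        · exact h4 _ _
        · intro d hd
          have hd := Finset.ne_of_mem_erase hd
          rw [h2 d hd]
          by_cases h : ∃ u, u ≠ 0 ∧ dual (edges v d) = slot u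
          · rw [if_pos h, if_neg fun h' => h'.2 h]
          · rw [if_neg h, if_pos ⟨hne d hd, h⟩]

/-- The encoder of the toric code: a linear circuit of depth `O(L)` that turns `X` on `slot v` into
the `X` plaquette at `v`, and `Z` on `dual (slot v)` into the `Z` plaquette dual to `v`. -/
theorem exists_encoder :
    ∃ (C : Circuit L) (M : Config L →+ Config L), C.depth = 16 * L ∧ C.toOp = permOp M ∧
      (∀ v, v ≠ 0 → M (Pi.single (slot v) 1) = ∑ d, Pi.single (edges v d) 1) ∧
      ∀ v, v ≠ 0 → ∀ z, ∑ d, M z (dual (edges v d)) = z (dual (slot v)) := by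
  classical
  obtain ⟨C, M, hC, hM, hfix, hstar⟩ := exists_star_circuit (L := L) (2 * L)
  obtain ⟨C', N, hC', hN, htree, -, hflux⟩ := exists_face_circuit (L := L) (2 * L)
  -- star operators carry no flux, so the first circuit only sees the non-tree edges
  have key : ∀ v z, ∑ d, M z (dual (edges v d)) = cotreeFlux v z := by
    intro v z
    let f : Config L →+ Fin 2 := AddMonoidHom.mk' (fun z => ∑ d, M z (dual (edges v d)))
      fun z w => by simp only [map_add, Pi.add_apply, Finset.sum_add_distrib]
    let g : Config L →+ Fin 2 := AddMonoidHom.mk' (cotreeFlux v) fun z w => by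
      rw [cotreeFlux, cotreeFlux, cotreeFlux, ← Finset.sum_add_distrib]
      refine Finset.sum_congr rfl fun d _ => ?_
      split_ifs <;> simp
    suffices f = g from DFunLike.congr_fun this z
    refine AddMonoidHom.functions_ext' _ _ _ fun q => ?_
    refine AddMonoidHom.ext fun x => ?_
    rcases (by decide : ∀ x : Fin 2, x = 0 ∨ x = 1) x with rfl | rfl
    · simp
    change ∑ d, M (Pi.single q 1) (dual (edges v d)) = cotreeFlux v (Pi.single q 1)
    by_cases hq : ∃ u, u ≠ 0 ∧ q = slot u
    · obtain ⟨u, hu, rfl⟩ := hq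
      rw [hstar u hu (height_lt u), sum_edges_dual_edges, cotreeFlux]
      refine (Finset.sum_eq_zero fun d _ => ?_).symm
      split_ifs with h
      · rfl
      · exact Pi.single_eq_of_ne (fun h' => h ⟨u, hu, h'⟩) _
    · rw [hfix, cotreeFlux]
      · refine Finset.sum_congr rfl fun d _ => ?_
        split_ifs with h
        · obtain ⟨u, hu, h'⟩ := h
          exact Pi.single_eq_of_ne (fun h'' => hq ⟨u, hu, h''.symm.trans h'⟩) _
        · rfl
      · intro u hu _
        exact Pi.single_eq_of_ne (fun h => hq ⟨u, hu, h.symm⟩) _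
  refine ⟨C' ++ C, M.comp N, ?_, ?_, ?_, ?_⟩
  · simp only [Circuit.depth, List.length_append] at hC hC' ⊢
    omega
  · rw [Circuit.toOp_append, hM, hN, permOp_comp_hom]
  · intro v hv
    rw [AddMonoidHom.comp_apply, htree, hstar v hv (height_lt v)]
    intro q hq
    refine ⟨v, hv, ?_⟩
    by_contra h
    exact hq (Pi.single_eq_of_ne h _)
  · intro v hv z
    rw [AddMonoidHom.comp_apply, key, hflux z v hv (height_lt v)]

end Encoder

/-! ### Distributing parities -/

section Preparation

variable {L : ℕ} [NeZero L]

/-- The total weight of the strings of `n` bits of parity `x`, a string with `k` ones having the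
weight `t ^ k`. -/
def parityWeight (t : ℝ) (n : ℕ) (x : Fin 2) : ℝ := ((1 + t) ^ n + sgn x * (1 - t) ^ n) / 2

theorem parityWeight_add (t : ℝ) (m n : ℕ) (x : Fin 2) :
    parityWeight t (m + n) x = parityWeight t m x * parityWeight t n 0 +
      parityWeight t m (x + 1) * parityWeight t n 1 := by
  fin_cases x <;> (simp [parityWeight, sgn, pow_add]; ring)

theorem parityWeight_zero (t : ℝ) (x : Fin 2) :
    parityWeight t 0 x = if x = 0 then 1 else 0 := by
  fin_cases x <;> simp [parityWeight, sgn]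

theorem parityWeight_one (t : ℝ) (x : Fin 2) :
    parityWeight t 1 x = if x = 0 then 1 else t := by
  fin_cases x <;> (simp [parityWeight, sgn]; try ring)

theorem parityWeight_pos {t : ℝ} (h0 : 0 < t) (h1 : t < 1) {n : ℕ} (hn : n ≠ 0) (x : Fin 2) :
    0 < parityWeight t n x := by
  have h2 : (1 - t) ^ n < (1 + t) ^ n :=
    pow_lt_pow_left₀ (by linarith) (by linarith) hn
  have h3 : 0 < (1 - t) ^ n := pow_pos (by linarith) n
  fin_cases x <;> simp [parityWeight, sgn] <;> linarith

theorem parityWeight_nonneg {t : ℝ} (h0 : 0 < t) (h1 : t < 1) (n : ℕ) (x : Fin 2) :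
    0 ≤ parityWeight t n x := by
  rcases eq_or_ne n 0 with rfl | hn
  · rw [parityWeight_zero]; split_ifs <;> norm_num
  · exact (parityWeight_pos h0 h1 hn x).le

/-- The real matrix of the gate `|x, 0⟩ ↦ c x |x, 0⟩ + s x |x + 1, 1⟩`, completed by
`|x + 1, 1⟩ ↦ - s x |x, 0⟩ + c x |x + 1, 1⟩`. -/
def splitMatrix (c s : Fin 2 → ℝ) : Matrix (Fin 2 × Fin 2) (Fin 2 × Fin 2) ℂ :=
  Matrix.of fun p r =>
    if p.1 + p.2 ≠ r.1 + r.2 then 0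
    else if p.2 = 0 then (if r.2 = 0 then (c (r.1 + r.2) : ℂ) else -(s (r.1 + r.2) : ℂ))
    else (if r.2 = 0 then (s (r.1 + r.2) : ℂ) else (c (r.1 + r.2) : ℂ))

theorem splitMatrix_mem {c s : Fin 2 → ℝ} (h : ∀ x, c x ^ 2 + s x ^ 2 = 1) :
    splitMatrix c s ∈ Matrix.unitaryGroup (Fin 2 × Fin 2) ℂ := by
  have h' : ∀ x, (c x : ℂ) ^ 2 + (s x : ℂ) ^ 2 = 1 := fun x => by exact_mod_cast h x
  have h0 := h' 0
  have h1 := h' 1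
  have e : (1 : Fin 2) + 1 = 0 := rfl
  rw [Matrix.mem_unitaryGroup_iff]
  ext ⟨a, b⟩ ⟨a', b'⟩
  fin_cases a <;> fin_cases b <;> fin_cases a' <;> fin_cases b' <;>
    simp [splitMatrix, Matrix.mul_apply, Fintype.sum_prod_type, Matrix.star_apply, e,
      ← pow_two] <;>
    first
      | linear_combination h0
      | linear_combination h1
      | ring

/-- The gate that splits a bit, the parity of `m + n` weighted bits, into the parities of the first
`m` and of the last `n` of them. -/
theorem exists_splitGate {t : ℝ} (h0 : 0 < t) (h1 : t < 1) (m n : ℕ) :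
    ∃ U : Matrix.unitaryGroup (Fin 2 × Fin 2) ℂ, m + n ≠ 0 → ∀ x y b : Fin 2,
      U.1 (x, y) (b, 0) = if b = x + y then
        ((√(parityWeight t m x * parityWeight t n y / parityWeight t (m + n) b) : ℝ) : ℂ)
        else 0 := by
  by_cases hmn : m + n = 0
  · exact ⟨1, fun h => absurd hmn h⟩
  set c : Fin 2 → ℝ := fun b =>
    √(parityWeight t m b * parityWeight t n 0 / parityWeight t (m + n) b) with hc
  set s : Fin 2 → ℝ := fun b =>
    √(parityWeight t m (b + 1) * parityWeight t n 1 / parityWeight t (m + n) b) with hs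
  have hpos := parityWeight_pos h0 h1 hmn
  have hnn := parityWeight_nonneg h0 h1
  refine ⟨⟨splitMatrix c s, splitMatrix_mem fun x => ?_⟩, fun _ x y b => ?_⟩
  · rw [hc, hs]
    dsimp only
    rw [Real.sq_sqrt (div_nonneg (mul_nonneg (hnn _ _) (hnn _ _)) (hpos x).le),
      Real.sq_sqrt (div_nonneg (mul_nonneg (hnn _ _) (hnn _ _)) (hpos x).le), ← add_div,
      ← parityWeight_add, div_self (hpos x).ne']
  · have e : (1 : Fin 2) + 1 = 0 := rfl
    fin_cases x <;> fin_cases y <;> fin_cases b <;> simp [splitMatrix, hc, hs, e]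

/-- The unnormalised amplitude of the basis state `z` at a stage of the preparation where the
qubit `q` holds the joint parity of `n q` bits. The factor `Φ` expresses the conservation laws. -/
def amplitude (t : ℝ) (Φ : Config L → ℝ) (n : Qubit L → ℕ) (z : Config L) : ℂ :=
  (√(Φ z * ∏ q, parityWeight t (n q) (z q)) : ℝ)

theorem prod_update_update {q r : Qubit L} (hqr : q ≠ r) (f : Qubit L → Fin 2 → ℝ)
    (z : Config L) (a b : Fin 2) :
    ∏ s, f s (Function.update (Function.update z q a) r b s) =
      f q a * f r b * ∏ s ∈ (Finset.univ.erase q).erase r, f s (z s) := by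
  rw [← Finset.mul_prod_erase Finset.univ _ (Finset.mem_univ q),
    ← Finset.mul_prod_erase _ _ (Finset.mem_erase.2 ⟨hqr.symm, Finset.mem_univ r⟩), mul_assoc]
  congr 1
  · simp [hqr]
  · congr 1
    · simp
    · refine Finset.prod_congr rfl fun s hs => ?_
      have h1 := Finset.ne_of_mem_erase hs
      have h2 := Finset.ne_of_mem_erase (Finset.mem_of_mem_erase hs)
      simp [h1, h2]

theorem splitGate_mulVec {t : ℝ} (h0 : 0 < t) (h1 : t < 1) {Φ : Config L → ℝ}
    {n n' : Qubit L → ℕ} {q r : Qubit L} (hqr : q ≠ r)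
    (hsymm : ∀ z, Φ (z + Pi.single q 1 + Pi.single r 1) = Φ z)
    (hq : n q = n' q + n' r) (hq0 : n q ≠ 0) (hr : n r = 0)
    (hn : ∀ s, s ≠ q → s ≠ r → n' s = n s)
    {U : Matrix.unitaryGroup (Fin 2 × Fin 2) ℂ}
    (hU : n' q + n' r ≠ 0 → ∀ x y b : Fin 2, U.1 (x, y) (b, 0) = if b = x + y then
      ((√(parityWeight t (n' q) x * parityWeight t (n' r) y /
        parityWeight t (n' q + n' r) b) : ℝ) : ℂ) else 0) :
    (onPair q r U.1).mulVec (amplitude t Φ n) = amplitude t Φ n' := by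
  have hU := hU (by omega)
  ext z
  rw [onPair_mulVec hqr, Fintype.sum_prod_type]
  -- the qubit `r` is still in the state `|0⟩`
  have hone : ∀ b, amplitude t Φ n (Function.update (Function.update z q b) r 1) = 0 := by
    intro b
    rw [amplitude, prod_update_update hqr (fun s => parityWeight t (n s)), hr,
      parityWeight_zero]
    simp
  have hΦz : Φ (Function.update (Function.update z q (z q + z r)) r 0) = Φ z := by
    rcases (by decide : ∀ x : Fin 2, x = 0 ∨ x = 1) (z r) with hz | hz
    · rw [hz, add_zero, Function.update_eq_self, ← hz, Function.update_eq_self]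
    · rw [← hsymm z]
      congr 1
      ext s : 1
      by_cases hs : s = r
      · subst hs; simp [hqr.symm, hz]
      by_cases hs' : s = q
      · subst hs'; simp [hs, hz]
      · simp [hs, hs']
  have hfin : ∀ b : Fin 2, ∑ c, U.1 (z q, z r) (b, c) *
      amplitude t Φ n (Function.update (Function.update z q b) r c) =
      if b = z q + z r then amplitude t Φ n' z else 0 := by
    intro b
    rw [Fin.sum_univ_two, hone, mul_zero, add_zero, hU]
    split_ifs with hb
    · subst hb
      have hz : z = Function.update (Function.update z q (z q)) r (z r) := by simp
      have hprod : ∏ s, parityWeight t (n' s) (z s) =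
          parityWeight t (n' q) (z q) * parityWeight t (n' r) (z r) *
            ∏ s ∈ (Finset.univ.erase q).erase r, parityWeight t (n s) (z s) := by
        conv_lhs => rw [hz]
        rw [prod_update_update hqr (fun s => parityWeight t (n' s))]
        congr 1
        refine Finset.prod_congr rfl fun s hs => ?_
        rw [hn s (Finset.ne_of_mem_erase (Finset.mem_of_mem_erase hs))
          (Finset.ne_of_mem_erase hs)]
      have hpos := parityWeight_pos h0 h1 (show n' q + n' r ≠ 0 by omega) (z q + z r)
      rw [amplitude, amplitude, hΦz, prod_update_update hqr (fun s => parityWeight t (n s)), hr,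
        parityWeight_zero, if_pos rfl, mul_one, ← Complex.ofReal_mul, hprod, hq,
        ← Real.sqrt_mul (div_nonneg (mul_nonneg (parityWeight_nonneg h0 h1 _ _)
          (parityWeight_nonneg h0 h1 _ _)) hpos.le)]
      congr 2
      field_simp
    · rw [zero_mul]
  rw [Finset.sum_congr rfl fun b _ => hfin b, Finset.sum_ite_eq']
  simp

/-- A layer of splits on disjoint pairs of neighbours. -/
theorem exists_layer_split {t : ℝ} (h0 : 0 < t) (h1 : t < 1) {Φ : Config L → ℝ}
    {ι : Type*} (l : List ι) (q r : ι → Qubit L)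
    (n n' : Qubit L → ℕ)
    (hneigh : ∀ i ∈ l, Neighbours (q i) (r i))
    (hd : l.Pairwise fun i j => Disjoint ({q i, r i} : Set (Qubit L)) {q j, r j})
    (hsymm : ∀ i ∈ l, ∀ z, Φ (z + Pi.single (q i) 1 + Pi.single (r i) 1) = Φ z)
    (hq : ∀ i ∈ l, n (q i) = n' (q i) + n' (r i)) (hq0 : ∀ i ∈ l, n (q i) ≠ 0)
    (hr : ∀ i ∈ l, n (r i) = 0)
    (hn : ∀ s, (∀ i ∈ l, s ≠ q i ∧ s ≠ r i) → n' s = n s) :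
    ∃ ℓ : Layer L, ℓ.toOp.mulVec (amplitude t Φ n) = amplitude t Φ n' := by
  choose U hU using fun i => exists_splitGate h0 h1 (n' (q i)) (n' (r i))
  obtain ⟨ℓ, hℓ⟩ := exists_layer_prod_onPair l q r U hneigh hd
  refine ⟨ℓ, ?_⟩
  rw [hℓ]
  replace hU := fun i (_ : i ∈ l) => hU i
  clear hℓ ℓ
  induction l generalizing n' with
  | nil =>
    have : n' = n := funext fun s => hn s (by simp)
    simp [this]
  | cons i l ih =>
    rw [List.pairwise_cons] at hd
    simp only [List.mem_cons, forall_eq_or_imp] at hneigh hsymm hq hq0 hr hn hU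
    have hqr := hneigh.1.1
    have hdisj : ∀ j ∈ l, (q j ≠ q i ∧ q j ≠ r i) ∧ r j ≠ q i ∧ r j ≠ r i := by
      intro j hj
      have := hd.1 j hj
      simp only [Set.disjoint_insert_left, Set.disjoint_singleton_left, Set.mem_insert_iff,
        Set.mem_singleton_iff, not_or] at this
      exact ⟨⟨Ne.symm this.1.1, Ne.symm this.2.1⟩, Ne.symm this.1.2, Ne.symm this.2.2⟩
    -- the stage at which the splits of `l` have been done, but not the one of `i`
    set n₁ := Function.update (Function.update n' (q i) (n (q i))) (r i) (n (r i)) with hn₁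
    have hq₁ : ∀ j ∈ l, n₁ (q j) = n' (q j) := fun j hj => by
      simp [hn₁, (hdisj j hj).1.1, (hdisj j hj).1.2]
    have hr₁ : ∀ j ∈ l, n₁ (r j) = n' (r j) := fun j hj => by
      simp [hn₁, (hdisj j hj).2.1, (hdisj j hj).2.2]
    have hqi : n₁ (q i) = n (q i) := by simp [hn₁, hqr]
    have hri : n₁ (r i) = n (r i) := by simp [hn₁]
    rw [List.map_cons, List.prod_cons, ← Matrix.mulVec_mulVec]
    have hrest : (l.map fun i => onPair (q i) (r i) (U i).1).prod.mulVec (amplitude t Φ n) =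
        amplitude t Φ n₁ := by
      refine ih n₁ hneigh.2 hd.2 hsymm.2 (fun j hj => ?_) hq0.2 hr.2 (fun s hs => ?_)
        fun j hj => ?_
      · rw [hq₁ j hj, hr₁ j hj, hq.2 j hj]
      · by_cases hs1 : s = r i
        · rw [hs1, hri]
        by_cases hs2 : s = q i
        · rw [hs2, hqi]
        rw [hn₁, Function.update_of_ne hs1, Function.update_of_ne hs2, hn s ⟨⟨hs2, hs1⟩, hs⟩]
      · rw [hq₁ j hj, hr₁ j hj]
        exact hU.2 j hj
    rw [hrest]
    refine splitGate_mulVec h0 h1 hqr hsymm.1 (by rw [hqi, hq.1]) (by rw [hqi]; exact hq0.1)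
      (by rw [hri, hr.1]) (fun s hs hs' => by simp [hn₁, hs, hs']) hU.1

end Preparation

/-! ### The thermal superposition -/

section Thermal

variable {L : ℕ}

/-- The qubit labelled by a vertex (`s = false`) or by a face (`s = true`). -/
def mark (s : Bool) (v : Vertex L) : Qubit L := if s then dual (slot v) else slot v

theorem mark_injective2 {s s' : Bool} {v v' : Vertex L}
    (h : mark s v = mark s' v') :
    s = s' ∧ v = v' := by
  cases s <;> cases s' <;> simp only [mark, if_true, if_false, Bool.false_eq_true] at h
  · exact ⟨rfl, slot_injective h⟩
  · exact absurd h (slot_ne_dual_slot _ _)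
  · exact absurd h.symm (slot_ne_dual_slot _ _)
  · exact ⟨rfl, slot_injective (dual_injective h)⟩

theorem val_cast_add_one {k : ℕ} (hk : k + 1 < L) : ((k : ZMod L) + 1).val = k + 1 := by
  rw [← Nat.cast_succ, ZMod.val_cast_of_lt hk]

variable [NeZero L]

/-- There are as many qubits as vertices and faces together, and `mark` matches them. The root of
each comb has a qubit, too. -/
def markEquiv (L : ℕ) [NeZero L] : Bool × Vertex L ≃ Qubit L :=
  Equiv.ofBijective (fun p => mark p.1 p.2) <| by
    rw [Fintype.bijective_iff_injective_and_card]
    refine ⟨fun p p' h => Prod.ext (mark_injective2 h).1 (mark_injective2 h).2, ?_⟩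
    simp only [Fintype.card_prod, Fintype.card_bool]
    ring

theorem markEquiv_apply (s : Bool) (v : Vertex L) : markEquiv L (s, v) = mark s v := rfl

theorem exists_mark_eq (q : Qubit L) : ∃ s v, q = mark s v :=
  ⟨_, _, ((markEquiv L).apply_symm_apply q).symm⟩

theorem prod_qubits (f : Qubit L → ℝ) :
    ∏ q, f q = ∏ s, (f (mark s 0) * ∏ v ∈ Finset.univ.erase 0, f (mark s v)) := by
  rw [← (markEquiv L).prod_comp, Fintype.prod_prod_type]
  exact Finset.prod_congr rfl fun s _ =>
    (Finset.mul_prod_erase Finset.univ (fun v => f (mark s v)) (Finset.mem_univ 0)).symm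

open Classical in
/-- The conservation laws: both the vertex bits and the face bits have even parity. The value is
normalised so that the preparation starts from a unit vector. -/
def parityFactor (t : ℝ) (z : Config L) : ℝ :=
  if ∀ s, ∑ v, z (mark s v) = 0 then (parityWeight t (L * L) 0 ^ 2)⁻¹ else 0

theorem parityFactor_add (t : ℝ) (s : Bool) (u v : Vertex L) (z : Config L) :
    parityFactor t (z + Pi.single (mark s u) 1 + Pi.single (mark s v) 1) = parityFactor t z := by
  have h1 : ∀ s' w, ∑ v : Vertex L, (Pi.single (mark s w) 1 : Config L) (mark s' v) =
      if s' = s then 1 else 0 := by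
    intro s' w
    by_cases hs : s' = s
    · subst hs
      rw [if_pos rfl, Finset.sum_eq_single w]
      · simp
      · intro b _ hb
        exact Pi.single_eq_of_ne (fun h => hb (mark_injective2 h).2) _
      · simp
    · rw [if_neg hs]
      exact Finset.sum_eq_zero fun b _ =>
        Pi.single_eq_of_ne (fun h => hs (mark_injective2 h).1) _
  have h2 : ∀ s', ∑ w : Vertex L,
      (z + Pi.single (mark s u) 1 + Pi.single (mark s v) 1 : Config L) (mark s' w) =
      ∑ w : Vertex L, z (mark s' w) := by
    intro s'
    simp only [Pi.add_apply, Finset.sum_add_distrib, h1]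
    rw [add_assoc, bit_add_self, add_zero]
  simp only [parityFactor, h2]

/-- The assignment to the qubits of numbers that are given for vertices and faces. -/
def spread (m : Bool → Vertex L → ℕ) (q : Qubit L) : ℕ :=
  m ((markEquiv L).symm q).1 ((markEquiv L).symm q).2

theorem spread_mark (m : Bool → Vertex L → ℕ) (s : Bool) (v : Vertex L) :
    spread m (mark s v) = m s v := by
  rw [spread, ← markEquiv_apply, Equiv.symm_apply_apply]

/-- A layer of splits along disjoint pairs of tree edges, or of dual tree edges. -/
theorem exists_layer_split_mark {t : ℝ} (h0 : 0 < t) (h1 : t < 1) (s : Bool)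
    (M : Bool → Vertex L → ℕ) (m' : Vertex L → ℕ) (l : List (Vertex L)) (hl : l.Nodup)
    (r : Vertex L → Vertex L) (hr : Function.Injective r)
    (hne : ∀ u ∈ l, ∀ v ∈ l, u ≠ r v)
    (hedge : ∀ u ∈ l, ∃ w d d', edges w d = slot u ∧ edges w d' = slot (r u))
    (hm : ∀ u ∈ l, M s u = m' u + m' (r u)) (hm0 : ∀ u ∈ l, M s u ≠ 0)
    (hmr : ∀ u ∈ l, M s (r u) = 0) (hoff : ∀ v, (∀ u ∈ l, v ≠ u ∧ v ≠ r u) → m' v = M s v) :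
    ∃ ℓ : Layer L, ℓ.toOp.mulVec (amplitude t (parityFactor t) (spread M)) =
      amplitude t (parityFactor t) (spread (Function.update M s m')) := by
  have hupd : ∀ v, spread (Function.update M s m') (mark s v) = m' v := fun v => by
    rw [spread_mark, Function.update_self]
  refine exists_layer_split h0 h1 l (fun u => mark s u) (fun u => mark s (r u)) _ _ ?_ ?_ ?_ ?_ ?_
    ?_ ?_
  · intro u hu
    obtain ⟨w, d, d', hd, hd'⟩ := hedge u hu
    have hdd : edges w d ≠ edges w d' := by
      rw [hd, hd']
      exact fun h => hne u hu u hu (slot_injective h)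
    cases s
    · simpa only [mark, hd, hd', if_false, Bool.false_eq_true] using neighbours_edges hdd
    · simpa only [mark, hd, hd', if_true] using neighbours_dual_edges hdd
  · refine hl.pairwise_of_forall_ne fun u hu v hv huv => ?_
    simp only [Set.disjoint_insert_left, Set.disjoint_singleton_left, Set.mem_insert_iff,
      Set.mem_singleton_iff, not_or]
    refine ⟨⟨fun h => huv (mark_injective2 h).2, fun h => hne u hu v hv (mark_injective2 h).2⟩,
      fun h => hne v hv u hu (mark_injective2 h).2.symm,
      fun h => huv (hr (mark_injective2 h).2)⟩
  · exact fun u _ z => parityFactor_add t s u (r u) z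
  · exact fun u hu => by rw [hupd, hupd, spread_mark, hm u hu]
  · exact fun u hu => by rw [spread_mark]; exact hm0 u hu
  · exact fun u hu => by rw [spread_mark]; exact hmr u hu
  · intro q hq
    obtain ⟨s', v, rfl⟩ := exists_mark_eq q
    by_cases hs : s' = s
    · subst hs
      rw [hupd, spread_mark]
      refine hoff v fun u hu => ⟨?_, ?_⟩
      · rintro rfl; exact (hq _ hu).1 rfl
      · rintro rfl; exact (hq _ hu).2 rfl
    · rw [spread_mark, spread_mark, Function.update_of_ne hs]

/-- The numbers of bits on a chain of `L` qubits after `k` splits: the qubits before `k` hold one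
bit each, and the qubit `k` the parity of all the others. -/
def chain (L k j : ℕ) : ℕ := if j < k then 1 else if j = k then L - k else 0

/-- The splits along the spine of the comb. -/
theorem exists_spine_circuit {t : ℝ} (h0 : 0 < t) (h1 : t < 1) (s : Bool)
    (M : Bool → Vertex L → ℕ) (hM : ∀ v, M s v = if v = 0 then L * L else 0) (k : ℕ) (hk : k < L) :
    ∃ C : Circuit L, C.depth = k ∧ C.toOp.mulVec (amplitude t (parityFactor t) (spread M)) =
      amplitude t (parityFactor t) (spread (Function.update M s fun v =>
        if v.2 = 0 then L * chain L k v.1.val else 0)) := by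
  induction k with
  | zero =>
    refine ⟨[], rfl, ?_⟩
    have : Function.update M s (fun v =>
        if v.2 = 0 then L * chain L 0 v.1.val else 0) = M := by
      rw [Function.update_eq_self_iff]
      ext v
      rw [hM]
      simp only [chain, Nat.not_lt_zero, if_false, ZMod.val_eq_zero, Nat.sub_zero, Prod.ext_iff,
        Prod.fst_zero, Prod.snd_zero]
      split_ifs <;> simp_all
    rw [this, Circuit.toOp_nil, Matrix.one_mulVec]
  | succ k ih =>
    obtain ⟨C, hC, hCM⟩ := ih (by omega)
    have hv : (k : ZMod L).val = k := ZMod.val_cast_of_lt (by omega)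
    have hv' := val_cast_add_one hk
    have h01 : (1 : ZMod L) ≠ 0 := by
      intro h
      rw [h, add_zero] at hv'
      omega
    obtain ⟨ℓ, hℓ⟩ := exists_layer_split_mark h0 h1 s
      (Function.update M s fun v => if v.2 = 0 then L * chain L k v.1.val else 0)
      (fun v => if v.2 = 0 then L * chain L (k + 1) v.1.val else 0)
      [((k : ZMod L), 0)] (List.nodup_singleton _) (fun v => (v.1 + 1, v.2))
      (fun v w h => by simpa [Prod.ext_iff] using h)
      (by simp [h01])
      (by
        simp only [List.mem_singleton, forall_eq]
        exact ⟨((k : ZMod L), 0), 0, 1, by simp [edges, xPlaquette, slot],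
          by simp [edges, xPlaquette, slot]⟩)
      (by
        simp only [List.mem_singleton, forall_eq, Function.update_self, if_true, hv, hv', chain]
        simp only [lt_irrefl, if_false, if_true, Nat.lt_succ_self]
        rw [← mul_add]
        congr 1
        omega)
      (by
        simp only [List.mem_singleton, forall_eq, Function.update_self, if_true, hv, chain,
          lt_irrefl, if_false]
        exact Nat.mul_ne_zero (by omega) (by omega))
      (by
        simp only [List.mem_singleton, forall_eq, Function.update_self, if_true, hv', chain]
        rw [if_neg (by omega), if_neg (by omega), mul_zero])
      (by
        simp only [List.mem_singleton, forall_eq, Function.update_self]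
        rintro ⟨i, j⟩ ⟨hi, hi'⟩
        by_cases hj : j = 0
        · subst hj
          have e1 : i.val ≠ k := fun h => hi (by rw [← h, ZMod.natCast_zmod_val])
          have e2 : i.val ≠ k + 1 := fun h => hi' (by
            rw [← Nat.cast_succ, Nat.succ_eq_add_one, ← h, ZMod.natCast_zmod_val])
          simp only [if_true, chain]
          congr 1
          split_ifs <;> omega
        · simp [hj])
    refine ⟨C ++ [ℓ], ?_, ?_⟩
    · simp only [Circuit.depth, List.length_append, List.length_singleton] at hC ⊢
      omega
    · rw [Circuit.toOp_append, ← Matrix.mulVec_mulVec, hCM, Circuit.toOp_cons, Circuit.toOp_nil,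
        one_mul, hℓ, Function.update_idem]

/-- The splits along the teeth of the comb, all the teeth in parallel. -/
theorem exists_teeth_circuit {t : ℝ} (h0 : 0 < t) (h1 : t < 1) (s : Bool)
    (M : Bool → Vertex L → ℕ) (hM : ∀ v, M s v = if v.2 = 0 then L else 0) (k : ℕ) (hk : k < L) :
    ∃ C : Circuit L, C.depth = k ∧ C.toOp.mulVec (amplitude t (parityFactor t) (spread M)) =
      amplitude t (parityFactor t) (spread (Function.update M s fun v => chain L k v.2.val)) := by
  induction k with
  | zero =>
    refine ⟨[], rfl, ?_⟩
    have : Function.update M s (fun v => chain L 0 v.2.val) = M := by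
      rw [Function.update_eq_self_iff]
      ext v
      rw [hM]
      simp only [chain, Nat.not_lt_zero, if_false, ZMod.val_eq_zero, Nat.sub_zero]
    rw [this, Circuit.toOp_nil, Matrix.one_mulVec]
  | succ k ih =>
    obtain ⟨C, hC, hCM⟩ := ih (by omega)
    have hv : (k : ZMod L).val = k := ZMod.val_cast_of_lt (by omega)
    have hv' := val_cast_add_one hk
    have h01 : (k : ZMod L) ≠ k + 1 := by
      intro h
      have := congrArg ZMod.val h
      omega
    have hk0 : (k : ZMod L) + 1 ≠ 0 := by
      intro h
      have := congrArg ZMod.val h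
      rw [ZMod.val_zero] at this
      omega
    obtain ⟨ℓ, hℓ⟩ := exists_layer_split_mark h0 h1 s
      (Function.update M s fun v => chain L k v.2.val)
      (fun v => chain L (k + 1) v.2.val)
      ((Finset.univ : Finset (ZMod L)).toList.map fun i => (i, (k : ZMod L)))
      ((Finset.nodup_toList _).map fun i j h => (Prod.ext_iff.1 h).1) (fun v => (v.1, v.2 + 1))
      (fun v w h => by simpa [Prod.ext_iff] using h)
      (by simp [h01])
      (by
        simp only [List.mem_map, Finset.mem_toList, Finset.mem_univ, true_and,
          forall_exists_index, forall_apply_eq_imp_iff]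
        intro i
        by_cases hk' : (k : ZMod L) = 0
        · refine ⟨(i, (k : ZMod L)), 0, 2, ?_, ?_⟩
          · simp [edges, xPlaquette, slot, hk']
          · rw [slot, if_neg hk0]
            simp [edges, xPlaquette]
        · refine ⟨(i, (k : ZMod L)), 3, 2, ?_, ?_⟩
          · rw [slot, if_neg hk']
            simp [edges, xPlaquette]
          · rw [slot, if_neg hk0]
            simp [edges, xPlaquette])
      (by
        simp only [List.mem_map, Finset.mem_toList, Finset.mem_univ, true_and,
          forall_exists_index, forall_apply_eq_imp_iff, Function.update_self, hv, hv', chain]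
        simp only [lt_irrefl, if_false, if_true, Nat.lt_succ_self]
        omega)
      (by
        simp only [List.mem_map, Finset.mem_toList, Finset.mem_univ, true_and,
          forall_exists_index, forall_apply_eq_imp_iff, Function.update_self, hv, chain,
          lt_irrefl, if_false, if_true]
        omega)
      (by
        simp only [List.mem_map, Finset.mem_toList, Finset.mem_univ, true_and,
          forall_exists_index, forall_apply_eq_imp_iff, Function.update_self, hv', chain]
        intro _
        rw [if_neg (by omega), if_neg (by omega)])
      (by
        simp only [List.mem_map, Finset.mem_toList, Finset.mem_univ, true_and,
          forall_exists_index, forall_apply_eq_imp_iff, Function.update_self]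
        rintro ⟨i, j⟩ h
        obtain ⟨hi, hi'⟩ := h i
        have e1 : j.val ≠ k := fun h => hi (by rw [← h, ZMod.natCast_zmod_val])
        have e2 : j.val ≠ k + 1 := fun h => hi' (by
          rw [← Nat.cast_succ, Nat.succ_eq_add_one, ← h, ZMod.natCast_zmod_val])
        simp only [chain]
        split_ifs <;> omega)
    refine ⟨C ++ [ℓ], ?_, ?_⟩
    · simp only [Circuit.depth, List.length_append, List.length_singleton] at hC ⊢
      omega
    · rw [Circuit.toOp_append, ← Matrix.mulVec_mulVec, hCM, Circuit.toOp_cons, Circuit.toOp_nil,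
        one_mul, hℓ, Function.update_idem]

/-- All the splits of the vertex bits, or of the face bits. -/
theorem exists_comb_circuit {t : ℝ} (h0 : 0 < t) (h1 : t < 1) (s : Bool)
    (M : Bool → Vertex L → ℕ) (hM : ∀ v, M s v = if v = 0 then L * L else 0) :
    ∃ C : Circuit L, C.depth ≤ 2 * L ∧ C.toOp.mulVec (amplitude t (parityFactor t) (spread M)) =
      amplitude t (parityFactor t) (spread (Function.update M s fun _ => 1)) := by
  have hL : 0 < L := Nat.pos_of_ne_zero (NeZero.ne L)
  have hend : ∀ i : ZMod L, chain L (L - 1) i.val = 1 := by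
    intro i
    have := ZMod.val_lt i
    unfold chain
    split_ifs <;> omega
  obtain ⟨C, hC, hCM⟩ := exists_spine_circuit h0 h1 s M hM (L - 1) (by omega)
  simp only [hend, mul_one] at hCM
  obtain ⟨C', hC', hCM'⟩ := exists_teeth_circuit h0 h1 s
    (Function.update M s fun v => if v.2 = 0 then L else 0) (by simp) (L - 1) (by omega)
  simp only [hend, Function.update_idem] at hCM'
  refine ⟨C ++ C', ?_, ?_⟩
  · simp only [Circuit.depth, List.length_append] at hC hC' ⊢
    omega
  · rw [Circuit.toOp_append, ← Matrix.mulVec_mulVec, hCM, hCM']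

theorem amplitude_start {t : ℝ} (h0 : 0 < t) (h1 : t < 1) :
    amplitude t (parityFactor t)
        (spread fun (_ : Bool) (v : Vertex L) => if v = 0 then L * L else 0) =
      Pi.single 0 1 := by
  have hpos := parityWeight_pos h0 h1 (Nat.mul_ne_zero (NeZero.ne L) (NeZero.ne L)) 0
  ext z
  rw [amplitude, prod_qubits]
  simp only [spread_mark, if_true]
  by_cases hz : ∀ s, ∀ v : Vertex L, v ≠ 0 → z (mark s v) = 0
  · have hsum : ∀ s, ∑ v : Vertex L, z (mark s v) = z (mark s 0) := fun s =>
      Fintype.sum_eq_single 0 (hz s)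
    have hprod : ∀ s, ∏ v ∈ Finset.univ.erase (0 : Vertex L),
        parityWeight t (if v = 0 then L * L else 0) (z (mark s v)) = 1 := by
      intro s
      refine Finset.prod_eq_one fun v hv => ?_
      have hv := Finset.ne_of_mem_erase hv
      rw [if_neg hv, hz s v hv, parityWeight_zero, if_pos rfl]
    simp only [parityFactor, hsum, hprod, mul_one, Fintype.prod_bool]
    by_cases hz0 : ∀ s, z (mark s 0) = 0
    · have : z = 0 := by
        ext q : 1
        obtain ⟨s, v, rfl⟩ := exists_mark_eq q
        by_cases hv : v = 0
        · rw [hv, hz0]; rfl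
        · rw [hz s v hv]; rfl
      rw [if_pos hz0, hz0, hz0, ← pow_two (parityWeight _ _ _),
          inv_mul_cancel₀ (pow_pos hpos 2).ne', Real.sqrt_one,
        this]
      simp
    · have : z ≠ 0 := by rintro rfl; exact hz0 fun s => rfl
      rw [if_neg hz0, zero_mul, Real.sqrt_zero, Pi.single_eq_of_ne this]
      rfl
  · have : z ≠ 0 := by rintro rfl; exact hz fun s v _ => rfl
    push Not at hz
    obtain ⟨s, v, hv, hzv⟩ := hz
    rw [Pi.single_eq_of_ne this, Finset.prod_eq_zero (Finset.mem_univ s), mul_zero,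
      Real.sqrt_zero]
    · rfl
    · rw [Finset.prod_eq_zero (Finset.mem_erase.2 ⟨hv, Finset.mem_univ v⟩), mul_zero]
      rw [if_neg hv, parityWeight_zero, if_neg hzv]

/-- The sum of the eigenvalues of the vertex operators, or of the face operators, that are encoded
in the bits `z`; the eigenvalue at the root is the product of the others. -/
def markEnergy (s : Bool) (z : Config L) : ℝ :=
  ∑ v ∈ Finset.univ.erase 0, sgn (z (mark s v)) + sgn (∑ v ∈ Finset.univ.erase 0, z (mark s v))

theorem exp_mul_sgn (β : ℝ) (x : Fin 2) :
    Real.exp (β * sgn x) = Real.exp β * parityWeight (Real.exp (-2 * β)) 1 x := by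
  rw [parityWeight_one]
  fin_cases x
  · simp [sgn]
  · simp [sgn, ← Real.exp_add]
    ring

/-- A circuit of depth `O(L)` that prepares from `|0⟩` a state whose squared amplitudes are the
Boltzmann weights of the syndromes; the two qubits off both trees are uniform. -/
theorem exists_thermal_circuit {β : ℝ} (hβ : 0 < β) :
    ∃ (C : Circuit L) (κ : ℝ), C.depth ≤ 4 * L + 1 ∧ ∀ z,
      Complex.normSq (C.toOp.mulVec (Pi.single 0 1) z) =
        κ * Real.exp (β * (markEnergy false z + markEnergy true z)) := by
  classical
  set t := Real.exp (-2 * β) with ht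
  have h0 : 0 < t := Real.exp_pos _
  have h1 : t < 1 := by rw [ht, Real.exp_lt_one_iff]; linarith
  obtain ⟨C, hC, hCM⟩ := exists_comb_circuit h0 h1 false
    (fun (_ : Bool) (v : Vertex L) => if v = 0 then L * L else 0) fun _ => rfl
  obtain ⟨C', hC', hCM'⟩ := exists_comb_circuit h0 h1 true
    (Function.update (fun (_ : Bool) (v : Vertex L) => if v = 0 then L * L else 0) false fun _ => 1)
    fun v => by rw [Function.update_of_ne (by simp)]
  set a : Qubit L := mark false 0 with ha
  set b : Qubit L := mark true 0 with hb
  have hab : a ≠ b := fun h => by simpa using (mark_injective2 h).1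
  let ℓ : Layer L := ⟨[.one a hadamard, .one b hadamard], by
    simpa [LocalGate.support] using hab⟩
  have hℓ : ℓ.toOp = onQubit a hadamard.1 * onQubit b hadamard.1 := by
    simp [ℓ, Layer.toOp, LocalGate.toOp]
  have hall : Function.update (Function.update (fun (_ : Bool) (v : Vertex L) =>
      if v = 0 then L * L else 0) false fun _ => 1) true (fun _ => 1) = fun _ _ => 1 := by
    ext s v
    cases s <;> simp
  rw [hall] at hCM'
  set N : ℝ := parityWeight t (L * L) 0 ^ 2 with hN
  refine ⟨C ++ C' ++ [ℓ], 1 / 4 * N⁻¹ * (Real.exp β ^ (2 * (L * L)))⁻¹, ?_, fun z => ?_⟩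
  · simp only [Circuit.depth, List.length_append, List.length_singleton] at hC hC' ⊢
    omega
  rw [Circuit.toOp_append, Circuit.toOp_append, ← Matrix.mulVec_mulVec, ← Matrix.mulVec_mulVec,
    ← amplitude_start h0 h1, hCM, hCM', Circuit.toOp_cons, Circuit.toOp_nil, one_mul, hℓ,
    ← Matrix.mulVec_mulVec]
  -- the parity constraints leave one term of the sums over the two root bits
  set p : Bool → Fin 2 := fun s => ∑ v ∈ Finset.univ.erase 0, z (mark s v) with hp
  have hu0 : ∀ x y, Function.update (Function.update z a x) b y a = x := fun x y => by simp [hab]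
  have hu1 : ∀ x y, Function.update (Function.update z a x) b y b = y := fun x y => by simp
  have hu2 : ∀ x y s, ∀ v ∈ Finset.univ.erase (0 : Vertex L),
      Function.update (Function.update z a x) b y (mark s v) = z (mark s v) := by
    intro x y s v hv
    have hv := Finset.ne_of_mem_erase hv
    rw [Function.update_of_ne fun h => hv (mark_injective2 h).2,
      Function.update_of_ne fun h => hv (mark_injective2 h).2]
  have hparity : ∀ x y, parityFactor t (Function.update (Function.update z a x) b y) =
      if x = p false ∧ y = p true then N⁻¹ else 0 := by
    intro x y
    have hsum : ∀ s, ∑ v, Function.update (Function.update z a x) b y (mark s v) =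
        Function.update (Function.update z a x) b y (mark s 0) + p s := by
      intro s
      rw [← Finset.add_sum_erase _ _ (Finset.mem_univ (0 : Vertex L)),
        Finset.sum_congr rfl (hu2 x y s)]
    have hbit : ∀ x y : Fin 2, x + y = 0 ↔ x = y := by decide
    simp only [parityFactor, hsum, Bool.forall_bool, ← ha, ← hb, hu0, hu1, hbit, ← hN]
  set W : ℝ := ∏ s, (parityWeight t 1 (p s) *
    ∏ v ∈ Finset.univ.erase 0, parityWeight t 1 (z (mark s v))) with hW
  have hamp : ∀ x y, amplitude t (parityFactor t) (spread fun _ _ => 1)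
      (Function.update (Function.update z a x) b y) =
      if x = p false ∧ y = p true then ((√(N⁻¹ * W) : ℝ) : ℂ) else 0 := by
    intro x y
    rw [amplitude, hparity]
    split_ifs with h
    · rw [prod_qubits]
      simp only [spread_mark]
      rw [hW]
      congr 4
      ext s
      congr 1
      · cases s
        · rw [← ha, hu0, h.1]
        · rw [← hb, hu1, h.2]
      · exact Finset.prod_congr rfl fun v hv => by rw [hu2 x y s v hv]
    · simp
  have hval : (onQubit a hadamard.1).mulVec ((onQubit b hadamard.1).mulVec
      (amplitude t (parityFactor t) (spread fun _ _ => 1))) z =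
      hadamard.1 (z a) (p false) * hadamard.1 (z b) (p true) * ((√(N⁻¹ * W) : ℝ) : ℂ) := by
    simp only [onQubit_mulVec, hamp, Function.update_of_ne hab.symm]
    rw [Fintype.sum_eq_single (p false), Fintype.sum_eq_single (p true)]
    · simp [mul_assoc]
    · intro y hy; simp [hy]
    · intro x hx; simp [hx]
  have hH : ∀ x y, Complex.normSq (hadamard.1 x y) = 1 / 2 := by
    intro x y
    rw [hadamard_apply, Complex.normSq_ofReal]
    have : (√2)⁻¹ * (√2)⁻¹ = (1 / 2 : ℝ) := by
      rw [← mul_inv, Real.mul_self_sqrt (by norm_num)]; norm_num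
    split_ifs <;> linear_combination this
  have hWnn : 0 ≤ N⁻¹ * W := by
    have := parityWeight_nonneg h0 h1
    refine mul_nonneg (inv_nonneg.2 (sq_nonneg _)) (Finset.prod_nonneg fun s _ => mul_nonneg
      (this _ _) (Finset.prod_nonneg fun v _ => this _ _))
  have hexp : Real.exp (β * (markEnergy false z + markEnergy true z)) =
      Real.exp β ^ (2 * (L * L)) * W := by
    have hcard : (Finset.univ.erase (0 : Vertex L)).card + 1 = L * L := by
      rw [Finset.card_erase_add_one (Finset.mem_univ _), Finset.card_univ, Fintype.card_prod,
        ZMod.card]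
    have hs : ∀ s, Real.exp (β * markEnergy s z) = Real.exp β ^ (L * L) *
        (parityWeight t 1 (p s) * ∏ v ∈ Finset.univ.erase 0, parityWeight t 1 (z (mark s v))) := by
      intro s
      rw [markEnergy, mul_add, Real.exp_add, Finset.mul_sum, Real.exp_sum, exp_mul_sgn,
        Finset.prod_congr rfl fun v _ => exp_mul_sgn β (z (mark s v)), Finset.prod_mul_distrib,
        Finset.prod_const, ← hcard, pow_succ]
      ring
    rw [mul_add, Real.exp_add, hs, hs, hW, Fintype.prod_bool]
    ring
  rw [hval, Complex.normSq_mul, Complex.normSq_mul, hH, hH, Complex.normSq_ofReal,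
    Real.mul_self_sqrt hWnn, hexp]
  have := Real.exp_pos β
  field_simp
  ring

end Thermal

/-! ### Diagonalising the Hamiltonian -/

section Hamiltonian

variable {L : ℕ} [NeZero L]

theorem hamiltonian_eq : hamiltonian L =
    -(∑ v : Vertex L, permOp fun z => z + ∑ d, Pi.single (edges v d) 1) -
      ∑ v : Vertex L, Matrix.diagonal fun z : Config L =>
        (sgn (∑ d, z (dual (edges v d))) : ℂ) := by
  rw [hamiltonian, ← Fintype.sum_prod_type', ← Fintype.sum_prod_type']
  congr 1
  · simp only [plaquetteTerm_pauliX]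
    rfl
  · rw [← Equiv.sum_comp
      ((Equiv.subLeft (-1 : ZMod L)).prodCongr (Equiv.subLeft (-1 : ZMod L)))]
    exact Finset.sum_congr rfl fun v _ => plaquetteTerm_zPlaquette v

/-- The circuit that diagonalises the Hamiltonian: Hadamard gates on the edges of the tree, then
the encoder. -/
theorem exists_diagonalising_circuit :
    ∃ C : Circuit L, C.depth = 16 * L + 1 ∧
      hamiltonian L * C.toOp = C.toOp * Matrix.diagonal fun z : Config L =>
        (-(markEnergy false z + markEnergy true z) : ℂ) := by
  classical
  obtain ⟨C, M, hC, hCM, hstar, hface⟩ := exists_encoder (L := L)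
  set T : Finset (Qubit L) := (Finset.univ.erase (0 : Vertex L)).image slot with hT
  obtain ⟨ℓ, hℓ⟩ := exists_layer_hadamardOp T
  set V : Finset (Vertex L) := Finset.univ.erase 0 with hV
  have hmem : ∀ v ∈ V, slot v ∈ T := fun v hv => Finset.mem_image_of_mem _ hv
  have hnot : ∀ v : Vertex L, dual (slot v) ∉ T := by
    intro v hv
    obtain ⟨u, -, h⟩ := Finset.mem_image.1 hv
    exact slot_ne_dual_slot u v h
  have hcirc : Circuit.toOp (ℓ :: C) = permOp M * hadamardOp T := by
    rw [Circuit.toOp_cons, hℓ, hCM]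
  -- a product of vertex operators is the image of a product of Pauli `Z` operators
  have hX : ∀ (a : Config L) (S : Finset (Vertex L)), S ⊆ V →
      a = M (∑ v ∈ S, Pi.single (slot v) 1) →
      permOp (fun z => z + a) * Circuit.toOp (ℓ :: C) =
        Circuit.toOp (ℓ :: C) * Matrix.diagonal fun z => (sgn (∑ v ∈ S, z (slot v)) : ℂ) := by
    rintro a S hS rfl
    have h1 : permOp (fun z => z + M (∑ v ∈ S, Pi.single (slot v) 1)) * permOp M =
        permOp M * permOp (fun z => z + ∑ v ∈ S, Pi.single (slot v) 1) := by
      rw [permOp_mul, permOp_mul]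
      congr 1
      ext1 z
      simp only [Function.comp_apply, map_add]
    rw [hcirc, ← mul_assoc, h1, mul_assoc,
      pauliX_sum_mul_hadamardOp S slot fun v hv => hmem v (hS hv), mul_assoc]
  have hZ : ∀ (f : Config L → Fin 2) (S : Finset (Vertex L)),
      (∀ z, f (M z) = ∑ v ∈ S, z (dual (slot v))) →
      (Matrix.diagonal fun z => (sgn (f z) : ℂ)) * Circuit.toOp (ℓ :: C) =
        Circuit.toOp (ℓ :: C) *
          Matrix.diagonal fun z => (sgn (∑ v ∈ S, z (dual (slot v))) : ℂ) := by
    intro f S hf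
    rw [hcirc, ← mul_assoc, diagonal_mul_permOp, mul_assoc]
    simp only [hf]
    rw [pauliZ_sum_mul_hadamardOp S (fun v => dual (slot v)) fun v _ => hnot v, mul_assoc]
  -- the plaquettes multiply to the identity, which expresses the one at the root by the others
  have hbit : ∀ x y : Fin 2, x + y = 0 → x = y := by decide
  have hroot : (∑ d, Pi.single (edges (0 : Vertex L) d) 1 : Config L) =
      M (∑ v ∈ V, Pi.single (slot v) 1) := by
    have h := sum_sum_edges config_add_self fun q : Qubit L => (Pi.single q 1 : Config L)
    rw [← Finset.add_sum_erase _ _ (Finset.mem_univ (0 : Vertex L))] at h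
    rw [map_sum, Finset.sum_congr rfl fun v hv => hstar v (Finset.ne_of_mem_erase hv)]
    exact funext fun q => hbit _ _ (congrFun h q)
  have hroot' : ∀ z, ∑ d, M z (dual (edges 0 d)) = ∑ v ∈ V, z (dual (slot v)) := by
    intro z
    have h := sum_sum_edges bit_add_self fun q : Qubit L => M z (dual q)
    rw [← Finset.add_sum_erase _ _ (Finset.mem_univ (0 : Vertex L))] at h
    rw [Finset.sum_congr rfl fun v hv => (hface v (Finset.ne_of_mem_erase hv) z).symm]
    exact hbit _ _ h
  refine ⟨ℓ :: C, ?_, ?_⟩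
  · simp only [Circuit.depth, List.length_cons] at hC ⊢
    omega
  have hXsum : (∑ v : Vertex L, permOp fun z => z + ∑ d, Pi.single (edges v d) 1) *
      Circuit.toOp (ℓ :: C) =
      Circuit.toOp (ℓ :: C) * Matrix.diagonal fun z => (markEnergy false z : ℂ) := by
    rw [Finset.sum_mul, ← Finset.sum_erase_add _ _ (Finset.mem_univ (0 : Vertex L)),
      hX _ V subset_rfl hroot, Finset.sum_congr rfl fun v hv =>
        hX (∑ d, Pi.single (edges v d) 1) {v} (Finset.singleton_subset_iff.2 hv)
          (by rw [Finset.sum_singleton, hstar v (Finset.ne_of_mem_erase hv)]),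
      ← Finset.mul_sum, ← mul_add]
    congr 1
    ext z w
    by_cases h : z = w
    · subst h
      simp [Matrix.sum_apply, markEnergy, mark, ← hV, -Finset.sum_erase_eq_sub]
    · simp [Matrix.sum_apply, h]
  have hZsum : (∑ v : Vertex L, Matrix.diagonal fun z : Config L =>
      (sgn (∑ d, z (dual (edges v d))) : ℂ)) * Circuit.toOp (ℓ :: C) =
      Circuit.toOp (ℓ :: C) * Matrix.diagonal fun z => (markEnergy true z : ℂ) := by
    rw [Finset.sum_mul, ← Finset.sum_erase_add _ _ (Finset.mem_univ (0 : Vertex L)),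
      hZ _ V hroot', Finset.sum_congr rfl fun v hv =>
        hZ (fun z => ∑ d, z (dual (edges v d))) {v}
          (fun z => by rw [Finset.sum_singleton, hface v (Finset.ne_of_mem_erase hv)]),
      ← Finset.mul_sum, ← mul_add]
    congr 1
    ext z w
    by_cases h : z = w
    · subst h
      simp [Matrix.sum_apply, markEnergy, mark, ← hV, -Finset.sum_erase_eq_sub]
    · simp [Matrix.sum_apply, h]
  rw [hamiltonian_eq, sub_mul, neg_mul, hXsum, hZsum, ← mul_neg, ← mul_sub]
  congr 1
  ext z w
  by_cases h : z = w
  · subst h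
    simp
    ring
  · simp [h]

end Hamiltonian

/-! ### The Gibbs state -/

section Gibbs

variable {L : ℕ} [NeZero L]

/-- If a unitary diagonalises the Hamiltonian, then conjugation by it turns any diagonal density
matrix proportional to the Boltzmann weights into the Gibbs state. -/
theorem conj_diagonal_eq_gibbsState {U : Op L} (hU : U ∈ Matrix.unitaryGroup (Config L) ℂ)
    {E : Config L → ℝ}
    (hH : hamiltonian L * U = U * Matrix.diagonal fun z => (E z : ℂ)) {β κ : ℝ} {p : Config L → ℝ}
    (hp : ∀ z, p z = κ * Real.exp (-β * E z)) (hsum : ∑ z, p z = 1) :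
    U * (Matrix.diagonal fun z => (p z : ℂ)) * U.conjTranspose = gibbsState L β := by
  have h1 : U * U.conjTranspose = 1 := Matrix.mem_unitaryGroup_iff.1 hU
  have h1' : U.conjTranspose * U = 1 := Matrix.mem_unitaryGroup_iff'.1 hU
  have hinv : U⁻¹ = U.conjTranspose := Matrix.inv_eq_right_inv h1
  have hexp : NormedSpace.exp (-(β : ℂ) • hamiltonian L) =
      U * (Matrix.diagonal fun z => (Real.exp (-β * E z) : ℂ)) * U.conjTranspose := by
    have h2 : -(β : ℂ) • hamiltonian L =
        U * (Matrix.diagonal fun z => ((-β * E z : ℝ) : ℂ)) * U⁻¹ := by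
      have h3 : (Matrix.diagonal fun z => ((-β * E z : ℝ) : ℂ)) =
          -(β : ℂ) • Matrix.diagonal fun z => (E z : ℂ) := by
        rw [← Matrix.diagonal_smul]
        congr 1
        ext z
        simp
      rw [h3, Matrix.mul_smul, ← hH, hinv, Matrix.smul_mul, mul_assoc, h1, mul_one]
    have hunit : IsUnit U := ⟨⟨U, U.conjTranspose, h1, h1'⟩, rfl⟩
    rw [h2, Matrix.exp_conj _ _ hunit, Matrix.exp_diagonal, hinv]
    congr 3
    ext z
    rw [Pi.coe_exp, ← Complex.exp_eq_exp_ℂ, Complex.ofReal_exp]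
  have htr : Matrix.trace (NormedSpace.exp (-(β : ℂ) • hamiltonian L)) =
      ((∑ z, Real.exp (-β * E z) : ℝ) : ℂ) := by
    rw [hexp, Matrix.trace_mul_cycle, h1', one_mul, Matrix.trace_diagonal]
    push_cast
    rfl
  have hκ : κ * ∑ z, Real.exp (-β * E z) = 1 := by
    rw [Finset.mul_sum, ← hsum]
    exact Finset.sum_congr rfl fun z _ => (hp z).symm
  have hκ' : (∑ z, Real.exp (-β * E z))⁻¹ = κ := (eq_inv_of_mul_eq_one_left hκ).symm
  have hdiag : (Matrix.diagonal fun z => (p z : ℂ)) =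
      (κ : ℂ) • Matrix.diagonal fun z => (Real.exp (-β * E z) : ℂ) := by
    rw [← Matrix.diagonal_smul]
    congr 1
    ext z
    simp only [hp z, Pi.smul_apply, smul_eq_mul, Complex.ofReal_mul]
  rw [gibbsState, htr, hexp, ← Complex.ofReal_inv, hκ', hdiag, Matrix.mul_smul, Matrix.smul_mul]

theorem sum_normSq_mulVec_single {U : Op L} (hU : U ∈ Matrix.unitaryGroup (Config L) ℂ)
    (w : Config L) : ∑ z, Complex.normSq (U.mulVec (Pi.single w 1) z) = 1 := by
  have h := congrFun (congrFun (Matrix.mem_unitaryGroup_iff'.1 hU) w) w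
  rw [Matrix.mul_apply, Matrix.one_apply_eq] at h
  have h2 : ((∑ z, Complex.normSq (U.mulVec (Pi.single w 1) z) : ℝ) : ℂ) = 1 := by
    refine Eq.trans ?_ h
    rw [Complex.ofReal_sum]
    refine Finset.sum_congr rfl fun z _ => ?_
    rw [Complex.normSq_eq_conj_mul_self, Matrix.mulVec_single_one, Matrix.star_apply]
    rfl
  exact_mod_cast h2

theorem mul_zeroState_mul_apply_self (U : Op L) (z : Config L) :
    (U * zeroState L * U.conjTranspose) z z =
      (Complex.normSq (U.mulVec (Pi.single 0 1) z) : ℂ) := by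
  rw [zeroState, Matrix.mulVec_single_one, Complex.normSq_eq_conj_mul_self, Matrix.mul_apply,
    Fintype.sum_eq_single 0]
  · simp [mul_comm]
  · intro w hw
    simp [Matrix.mul_single_apply_of_ne, hw]

end Gibbs

end ToricCode

end

theorem theorem2 :
    ∃ C : ℕ, ∀ (L : ℕ) [NeZero L] (β : ℝ), 0 < β →
      ∃ a : ToricCode.LocalAlgorithm L,
        ToricCode.Circuit.depth a.pre ≤ C * L ∧
        a.simultaneous.card = 2 * L ^ 2 - 2 ∧
        a.numMeasurements ≤ 2 * L ^ 2 + C ∧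
        ToricCode.Circuit.depth a.post ≤ C * L ∧
        a.output = ToricCode.gibbsState L β := by
  open ToricCode in
  classical
  refine ⟨17, fun L _ β hβ => ?_⟩
  have hL : 1 ≤ L := Nat.one_le_iff_ne_zero.2 (NeZero.ne L)
  obtain ⟨A, κ, hA, hψ⟩ := exists_thermal_circuit (L := L) hβ
  obtain ⟨B, hB, hBH⟩ := exists_diagonalising_circuit (L := L)
  have hab : slot (0 : Vertex L) ≠ dual (slot 0) := slot_ne_dual_slot 0 0
  have hcard : ({slot (0 : Vertex L), dual (slot 0)}ᶜ : Finset (Qubit L)).card =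
      2 * L ^ 2 - 2 := by
    rw [Finset.card_compl, Finset.card_pair hab]
    simp only [Fintype.card_prod, ZMod.card, Fintype.card_bool]
    congr 1
    ring
  refine ⟨⟨A, {slot 0, dual (slot 0)}ᶜ, [slot 0, dual (slot 0)], B⟩, ?_, hcard, ?_, ?_, ?_⟩
  · exact hA.trans (by omega)
  · simp only [LocalAlgorithm.numMeasurements, hcard, List.length_cons, List.length_nil]
    omega
  · exact hB.le.trans (by omega)
  · rw [LocalAlgorithm.output]
    dsimp only
    rw [Circuit.apply_eq, Circuit.apply_eq, foldl_measureQubits_eq_diagonal]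
    · simp only [mul_zeroState_mul_apply_self]
      refine conj_diagonal_eq_gibbsState B.toOp_mem_unitaryGroup
        (E := fun z => -(markEnergy false z + markEnergy true z)) (κ := κ) ?_ ?_
        (sum_normSq_mulVec_single A.toOp_mem_unitaryGroup 0)
      · rw [hBH]
        congr 2
        ext z
        push_cast
        rfl
      · intro z
        rw [hψ, neg_mul_neg]
    · intro q
      simp only [Finset.mem_compl, Finset.mem_insert, Finset.mem_singleton, List.mem_cons,
        List.not_mem_nil, or_false]
      tauto
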